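/- Let $X$ be a complex Banach space, $B=\{x\in X:\|x\|<1\}$, and for $x\in X$ let $J(x)=\{x^*\in X^*:\langle x,x^*\rangle=\|x\|^2=\|x^*\|^2\}$. Let $h:B\to X$ be holomorphic (Fréchet differentiable over $\mathbb C$ at each point of $B$) and let $\omega\in\mathbb R$. For $\alpha\in\mathbb R$ with $\alpha\omega\neq1$, the Abel average is $\Phi_\alpha=(I-\alpha h)^{-1}\circ[(1-\alpha\omega)I]$. We write $\Phi_\alpha\in\mathrm{Hol}(B)$ if for every $x\in B$ there is exactly one $y\in B$ with $y-\alpha h(y)=(1-\alpha\omega)x$, and the map $\Phi_\alpha:x\mapsto y$ from $B$ to $B$ is holomorphic. Further: - $h$ is $\omega$-dissipative if there are $\varepsilon>0$ and $\varsigma\in\mathbb R$ such that $\mathrm{Re}\langle h(x),x^*\rangle\le\omega\|x\|^2+\varsigma(1-\|x\|^2)$ for all $x\in B$ with $1-\varepsilon<\|x\|<1$ and all $x^*\in J(x)$. - The numerical radius of $h$ is $L(h)=\limsup_{s\to1^-}\,\sup\{\mathrm{Re}\langle h(sx),x^*\rangle:\|x\|=1,\ x^*\in J(x)\}\in[-\infty,+\infty]$.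 - $h$ has unit radius of boundedness if $\sup_{\|x\|\le r}\|h(x)\|<\infty$ for each $r\in(0,1)$. - $h$ is $\omega$-pseudo-contractive if there is $\delta>0$ such that $\Phi_\alpha\in\mathrm{Hol}(B)$ for each $\alpha\in(0,\delta)$. - $Q_\omega=[0,1/\omega)$ if $\omega>0$, $Q_0=[0,+\infty)$, and $Q_\omega=(-\infty,1/\omega)\cup[0,+\infty)$ if $\omega<0$. Theorem. The following statements are equivalent: (i) $h$ is $\omega$-dissipative. (ii) $L(h)\le\omega$. (iii) $h$ has unit radius of boundedness and is $\omega$-pseudo-contractive, and, for all $x\in B$, in the norm of $X$, $$\lim_{\alpha\to0^+}\Phi_\alpha(x)=x,\qquad \lim_{\alpha\to0^+}\frac{\Phi_\alpha(x)-x}{\alpha}=h(x)-\omega x .$$ (iv) $h$ has unit radius of boundedness and $\Phi_\alpha\in\mathrm{Hol}(B)$ for each $\alpha\in Q_\omega$. -/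

import Mathlib

open Set Filter Topology

noncomputable section

namespace AbelAverage

variable {X : Type*} [NormedAddCommGroup X] [NormedSpace ℂ X]

/-- The normalized duality map
`J x = {x* ∈ X* : ‖x‖² = ⟨x, x*⟩ = ‖x*‖²}` of a complex normed space. -/
def dualityMap (x : X) : Set (StrongDual ℂ X) :=
  {φ | φ x = ((‖x‖ ^ 2 : ℝ) : ℂ) ∧ ‖φ‖ ^ 2 = ‖x‖ ^ 2}

/-- A map `h : D → X`, with `D` a (dense) subset of the open unit ball, is `ω`-dissipative if for
some `ε > 0` and `ς ∈ ℝ` one has `Re ⟨h x, x*⟩ ≤ ω ‖x‖² + ς (1 - ‖x‖²)` for all `x ∈ D` with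
`1 - ε < ‖x‖ < 1` and all `x* ∈ J x`. -/
def IsDissipative (ω : ℝ) (D : Set X) (h : X → X) : Prop :=
  ∃ ε > (0 : ℝ), ∃ ς : ℝ, ∀ x ∈ D, 1 - ε < ‖x‖ → ‖x‖ < 1 → ∀ φ ∈ dualityMap x,
    (φ (h x)).re ≤ ω * ‖x‖ ^ 2 + ς * (1 - ‖x‖ ^ 2)

/-- The numerical range `{⟨f x, x*⟩ : ‖x‖ = 1, x* ∈ J x}` of a map `f` that is defined on the
unit sphere. -/
def numericalRange (f : X → X) : Set ℂ :=
  {c | ∃ x : X, ‖x‖ = 1 ∧ ∃ φ ∈ dualityMap x, c = φ (f x)}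

/-- The numerical radius `L(h) = limsup_{s → 1⁻} sup Re N(h_s)`, where `h_s x = h (s x)`, as an
extended real number. -/
def numericalRadius (h : X → X) : EReal :=
  limsup (fun s : ℝ => ⨆ c ∈ numericalRange (fun x => h (s • x)), (c.re : EReal)) (𝓝[<] 1)

/-- `h` has unit radius of boundedness: it is bounded on each closed ball about `0` of radius
`r ∈ (0, 1)`. -/
def HasUnitRadiusOfBoundedness (h : X → X) : Prop :=
  ∀ r : ℝ, 0 < r → r < 1 → ∃ C : ℝ, ∀ x ∈ Metric.closedBall (0 : X) r, ‖h x‖ ≤ C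

/-- The Abel average `Φ_α = (I - α h)⁻¹ ∘ ((1 - α ω) I)` of `h : D → X`. The value at `x` is a
solution `y ∈ D` of `y - α h y = (1 - α ω) x`; it is meaningful where this solution exists and is
unique, which is part of `AbelAverageIsHol`. -/
def abelAverage (ω : ℝ) (D : Set X) (h : X → X) (α : ℝ) (x : X) : X :=
  Function.invFunOn (fun y => y - α • h y) D ((1 - α * ω) • x)

/-- `Φ_α ∈ Hol(B, D)`, where `B` is the open unit ball: for each `x ∈ B` the point `(1 - α ω) x`
has exactly one preimage in `D` under `I - α h`, and the resulting map `Φ_α : B → D` is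
holomorphic. -/
def AbelAverageIsHol (ω : ℝ) (D : Set X) (h : X → X) (α : ℝ) : Prop :=
  (∀ x ∈ Metric.ball (0 : X) 1, ∃! y : X, y ∈ D ∧ y - α • h y = (1 - α * ω) • x) ∧
    DifferentiableOn ℂ (abelAverage ω D h α) (Metric.ball (0 : X) 1)

/-- `h : D → X` is `ω`-pseudo-contractive: for some `δ > 0`, the Abel average `Φ_α` is in
`Hol(B, D)` for each `α ∈ (0, δ)`. -/
def IsPseudoContractive (ω : ℝ) (D : Set X) (h : X → X) : Prop :=
  ∃ δ > (0 : ℝ), ∀ α ∈ Ioo 0 δ, AbelAverageIsHol ω D h α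

/-- The parameter set `Q_ω`. -/
def paramSet (ω : ℝ) : Set ℝ :=
  if 0 < ω then Ico 0 (1 / ω)
  else if ω = 0 then Ici 0
  else Iio (1 / ω) ∪ Ici 0

end AbelAverage

end

/-! Put `g = h - ωI`. Every implication passes through the global one-sided estimate (E) Re ⟨g x,
x*⟩ ≤ M ‖x‖ (1 - ‖x‖²) for all `x` in the ball and `x* ∈ J x`, with `M = ‖g 0‖`.

From the numerical radius to (E): for a unit vector `u` and `φ ∈ J u`, the slice `ψ ζ = φ (g (ζ •
u))` has Re (ζ̄ ψ(ζ)) asymptotically nonpositive at the unit circle. Since ζ̄ ψ(0) and ζ conj ψ(0)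
have the same real part, the maximum principle applies to a holomorphic function
(`re_add_dslope_nonpos`), and (E) follows (`re_conj_mul_le`). The same inequality bounds `g` on
smaller balls (`hasUnitRadiusOfBoundedness_of_re_slice_nonpos`): Borel–Carathéodory makes the
numerical ranges of the Taylor terms decay geometrically, and `norm_le_of_numericalRange_le` turns
this into decay of their norms.

From (E) and boundedness to the Abel averages: for nonzero `α ∈ Q_ω` the number `μ = 1/α - ω` is
positive and the equation reads `y - μ⁻¹ g y = x`. Its solutions are the fixed points of a small
Euler step, which by (E) maps a ball strictly into itself, so the Earle–Hamilton theorem gives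
existence, uniqueness and an invertible derivative (`existsUnique_sub_eq`); the inverse function
theorem gives holomorphy.

The limits as `α → 0⁺` come from a local contraction argument together with uniqueness
(`tendsto_abelAverage`). Conversely, the quotients `(Φ_α - I)/α` of self-maps of the ball satisfy
the slice condition, and their limit `g` inherits (E) (`re_le_of_tendsto_selfMaps`), which contains
dissipativity. -/

namespace AbelAverage

open ComplexConjugate

/-! ### One-sided estimates on the disc and on complex slices. -/

/-- If `Re (ζ̄ ψ(ζ))` is asymptotically nonpositive at the unit circle, then the holomorphic
function `ζ ψ(0)̄ + (ψ(ζ) - ψ(0)) / ζ` has nonpositive real part on the disc. -/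
theorem re_add_dslope_nonpos {ψ : ℂ → ℂ} (hψ : DifferentiableOn ℂ ψ (Metric.ball 0 1))
    (hb : ∀ ε > 0, ∀ᶠ s : ℝ in 𝓝[<] 1, ∀ ζ : ℂ, ‖ζ‖ = s → (conj ζ * ψ ζ).re ≤ ε)
    {ζ : ℂ} (hζ : ‖ζ‖ < 1) : (ζ * conj (ψ 0) + dslope ψ 0 ζ).re ≤ 0 := by
  have hq : DifferentiableOn ℂ (dslope ψ 0) (Metric.ball 0 1) :=
    (Complex.differentiableOn_dslope (Metric.ball_mem_nhds 0 one_pos)).2 hψ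
  have key : ∀ ε > 0, (ζ * conj (ψ 0) + dslope ψ 0 ζ).re ≤ ε := by
    intro ε hε
    -- On the circle of radius `s` one has `s² = z̄ z`, so with the factor `s²` the real part is
    -- exactly Re (z̄ ψ(z)). The exponential turns the bound on a real part into a bound on a norm,
    -- and the maximum principle carries it inside.
    have h1 : ∀ᶠ s : ℝ in 𝓝[<] 1, (ζ * conj (ψ 0) + (s : ℂ) ^ 2 * dslope ψ 0 ζ).re ≤ ε := by
      filter_upwards [hb ε hε, Ioo_mem_nhdsLT hζ] with s hs hs1
      have hs0 : 0 < s := lt_of_le_of_lt (norm_nonneg ζ) hs1.1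
      have hsub : Metric.closedBall (0 : ℂ) s ⊆ Metric.ball 0 1 :=
        Metric.closedBall_subset_ball hs1.2
      have hF : DifferentiableOn ℂ
          (fun z => Complex.exp (z * conj (ψ 0) + (s : ℂ) ^ 2 * dslope ψ 0 z))
          (Metric.ball 0 1) := by fun_prop
      have := Complex.norm_le_of_forall_mem_frontier_norm_le (U := Metric.ball (0 : ℂ) s)
        (C := Real.exp ε) Metric.isBounded_ball
        (DifferentiableOn.diffContOnCl (by
          rw [closure_ball _ hs0.ne']; exact hF.mono hsub)) ?_
        (z := ζ) (subset_closure (by simpa using hs1.1))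
      · rw [Complex.norm_exp, Real.exp_le_exp] at this
        exact this
      · intro z hz
        rw [frontier_ball _ hs0.ne'] at hz
        have hz' : ‖z‖ = s := by simpa using hz
        rw [Complex.norm_exp, Real.exp_le_exp]
        refine le_trans (le_of_eq ?_) (hs z hz')
        have e1 : ψ z = ψ 0 + z * dslope ψ 0 z := by
          have := sub_smul_dslope ψ 0 z
          simp only [sub_zero, smul_eq_mul] at this
          rw [this]; ring
        have e2 : (s : ℂ) ^ 2 = conj z * z := by
          rw [Complex.conj_mul', hz']
        have e3 : (z * conj (ψ 0)).re = (conj z * ψ 0).re := by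
          simp [Complex.mul_re]
        rw [e2]
        conv_rhs => rw [e1]
        rw [mul_add, Complex.add_re, Complex.add_re, e3, mul_assoc]
    have h2 : Tendsto (fun s : ℝ => (ζ * conj (ψ 0) + (s : ℂ) ^ 2 * dslope ψ 0 ζ).re) (𝓝[<] 1)
        (𝓝 (ζ * conj (ψ 0) + ((1 : ℝ) : ℂ) ^ 2 * dslope ψ 0 ζ).re) := by
      refine (Continuous.tendsto ?_ _).mono_left nhdsWithin_le_nhds
      fun_prop
    simpa using le_of_tendsto h2 h1
  exact le_of_forall_pos_le_add (fun ε hε => by simpa using key ε hε)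

/-- With `q = dslope ψ 0`, Re (ζ̄ ψ(ζ)) = Re (ζ̄ ψ(0)) + |ζ|² Re q(ζ), and the hypothesis says Re
q(ζ) ≤ -Re (ζ̄ ψ(0)); this is where the factor 1 - |ζ|² comes from. -/
theorem re_conj_mul_le {ψ : ℂ → ℂ} {ζ : ℂ} (hζ : ‖ζ‖ < 1)
    (h : (ζ * conj (ψ 0) + dslope ψ 0 ζ).re ≤ 0) :
    (conj ζ * ψ ζ).re ≤ (1 - ‖ζ‖ ^ 2) * (‖ζ‖ * ‖ψ 0‖) := by
  have e1 : ψ ζ = ψ 0 + ζ * dslope ψ 0 ζ := by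
    have := sub_smul_dslope ψ 0 ζ
    simp only [sub_zero, smul_eq_mul] at this
    rw [this]; ring
  have e2 : ((‖ζ‖ ^ 2 : ℝ) : ℂ) = conj ζ * ζ := by
    rw [Complex.conj_mul']; simp
  have e3 : (ζ * conj (ψ 0)).re = (conj ζ * ψ 0).re := by
    simp [Complex.mul_re]
  have e4 : (conj ζ * ψ ζ).re = (conj ζ * ψ 0).re + ‖ζ‖ ^ 2 * (dslope ψ 0 ζ).re := by
    rw [e1, mul_add, ← mul_assoc, ← e2, Complex.add_re, Complex.re_ofReal_mul]
  have e5 : (conj ζ * ψ 0).re ≤ ‖ζ‖ * ‖ψ 0‖ := by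
    refine (Complex.re_le_norm _).trans ?_
    simp
  rw [Complex.add_re, e3] at h
  rw [e4]
  have h0 : 0 ≤ ‖ζ‖ := norm_nonneg ζ
  nlinarith [sq_nonneg ‖ζ‖, mul_le_mul_of_nonneg_left e5 (show 0 ≤ 1 - ‖ζ‖ ^ 2 by nlinarith)]

variable {X : Type*} [NormedAddCommGroup X] [NormedSpace ℂ X]

theorem norm_of_mem_dualityMap {x : X} {φ : StrongDual ℂ X} (h : φ ∈ dualityMap x) :
    ‖φ‖ = ‖x‖ :=
  (sq_eq_sq₀ (norm_nonneg _) (norm_nonneg _)).1 h.2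

theorem smul_mem_dualityMap {x : X} {φ : StrongDual ℂ X} (h : φ ∈ dualityMap x) (c : ℂ) :
    conj c • φ ∈ dualityMap (c • x) := by
  refine ⟨?_, ?_⟩
  · have : conj c * c = ((‖c‖ ^ 2 : ℝ) : ℂ) := by rw [Complex.conj_mul']; simp
    simp only [map_smul, smul_eq_mul, smul_apply, h.1, norm_smul]
    rw [← mul_assoc, mul_comm c, this]
    push_cast; ring
  · rw [norm_smul, norm_smul, norm_of_mem_dualityMap h]; simp

theorem dualityMap_nonempty (x : X) : (dualityMap x).Nonempty := by
  by_cases hx : ‖x‖ = 0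
  · exact ⟨0, by simp [hx], by simp [hx]⟩
  · obtain ⟨φ, h1, h2⟩ := exists_dual_vector ℂ x hx
    refine ⟨((‖x‖ : ℝ) : ℂ) • φ, ?_, ?_⟩
    · simp [h2, sq]
    · simp [norm_smul, h1]

/-- Every `φ ∈ J x`, `x ≠ 0`, is `‖x‖` times an element of `J u` with `u = x / ‖x‖`. -/
theorem exists_unit_of_mem_dualityMap {x : X} (hx : x ≠ 0) {φ : StrongDual ℂ X}
    (h : φ ∈ dualityMap x) : ∃ u : X, ∃ χ ∈ dualityMap u, ‖u‖ = 1 ∧ ((‖x‖ : ℝ) : ℂ) • u = x ∧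
      ((‖x‖ : ℝ) : ℂ) • χ = φ := by
  have h0 : ((‖x‖ : ℝ) : ℂ) ≠ 0 := by simpa using hx
  refine ⟨((‖x‖ : ℝ) : ℂ)⁻¹ • x, ((‖x‖ : ℝ) : ℂ)⁻¹ • φ, ?_, ?_, ?_, ?_⟩
  · simpa using smul_mem_dualityMap h (((‖x‖ : ℝ) : ℂ)⁻¹)
  · simp [norm_smul, hx]
  · rw [smul_inv_smul₀ h0]
  · rw [smul_inv_smul₀ h0]

/-- The restriction of `g` to the complex line through `u` is holomorphic on the unit disc. -/
theorem differentiableOn_slice {g : X → X} (hg : DifferentiableOn ℂ g (Metric.ball 0 1)) {u : X}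
    (hu : ‖u‖ ≤ 1) : DifferentiableOn ℂ (fun ζ : ℂ => g (ζ • u)) (Metric.ball 0 1) := by
  refine hg.comp (by fun_prop) ?_
  intro ζ hζ
  simp only [Metric.mem_ball, dist_zero_right, norm_smul] at hζ ⊢
  nlinarith [norm_nonneg ζ, norm_nonneg u]

/-- A radial upper estimate for the numerical range gives an estimate on complex slices. -/
theorem re_conj_mul_slice {g : X → X} {s C : ℝ}
    (h : ∀ u : X, ‖u‖ = 1 → ∀ φ ∈ dualityMap u, (φ (g ((s : ℂ) • u))).re ≤ C)
    (hs : 0 < s) {u : X} (hu : ‖u‖ = 1) {φ : StrongDual ℂ X} (hφ : φ ∈ dualityMap u) {ζ : ℂ}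
    (hζ : ‖ζ‖ = s) : (conj ζ * φ (g (ζ • u))).re ≤ s * C := by
  have hs0 : (s : ℂ) ≠ 0 := by simpa using hs.ne'
  -- Write `ζ • u = s • ((ζ / s) • u)`: the phase `ζ / s` is absorbed into the unit vector, and its
  -- conjugate into the functional.
  have h1 := h ((ζ / s) • u) (by simp [norm_smul, hu, hζ, abs_of_pos hs, hs.ne']) _
    (smul_mem_dualityMap hφ (ζ / s))
  rw [smul_smul, mul_div_cancel₀ _ hs0] at h1
  have : conj ζ * φ (g (ζ • u)) = s * (conj (ζ / s) • φ) (g (ζ • u)) := by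
    simp only [smul_apply, smul_eq_mul, map_div₀, Complex.conj_ofReal]
    field_simp
  rw [this, Complex.re_ofReal_mul]
  gcongr

/-- An asymptotic numerical range estimate at the unit sphere propagates to slices. -/
theorem re_slice_nonpos {g : X → X} (hg : DifferentiableOn ℂ g (Metric.ball 0 1))
    (h : ∀ ε > 0, ∀ᶠ s : ℝ in 𝓝[<] 1, ∀ u : X, ‖u‖ = 1 → ∀ φ ∈ dualityMap u,
      (φ (g ((s : ℂ) • u))).re ≤ ε)
    {u : X} (hu : ‖u‖ = 1) {φ : StrongDual ℂ X} (hφ : φ ∈ dualityMap u) {ζ : ℂ} (hζ : ‖ζ‖ < 1) :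
    (ζ * conj (φ (g 0)) + dslope (fun z : ℂ => φ (g (z • u))) 0 ζ).re ≤ 0 := by
  have := re_add_dslope_nonpos (ψ := fun z : ℂ => φ (g (z • u)))
    (φ.differentiable.comp_differentiableOn (differentiableOn_slice hg hu.le)) ?_ hζ
  · simpa using this
  · intro ε hε
    filter_upwards [h ε hε, Ioo_mem_nhdsLT (zero_lt_one' ℝ)] with s hs hs1 z hz
    have := re_conj_mul_slice hs hs1.1 hu hφ hz
    nlinarith [hs1.2]

/-- A point `x ≠ 0` lies on the slice through `u = x / ‖x‖` at the real parameter `ζ = ‖x‖`, so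
slice estimates give estimates at every point of the ball. -/
theorem re_le_of_slice {g : X → X} {M : ℝ}
    (h : ∀ u : X, ‖u‖ = 1 → ∀ φ ∈ dualityMap u, ∀ ζ : ℂ, ‖ζ‖ < 1 →
      (conj ζ * φ (g (ζ • u))).re ≤ (1 - ‖ζ‖ ^ 2) * (‖ζ‖ * M))
    {x : X} (hx : ‖x‖ < 1) {φ : StrongDual ℂ X} (hφ : φ ∈ dualityMap x) :
    (φ (g x)).re ≤ M * ‖x‖ * (1 - ‖x‖ ^ 2) := by
  rcases eq_or_ne x 0 with rfl | h0
  · have : φ = 0 := by simpa using norm_of_mem_dualityMap hφ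
    simp [this]
  · obtain ⟨u, χ, hχ, hu, e1, e2⟩ := exists_unit_of_mem_dualityMap h0 hφ
    have := h u hu χ hχ ((‖x‖ : ℝ) : ℂ) (by simpa using hx)
    rw [e1] at this
    rw [← e2]
    simp only [Complex.conj_ofReal, Complex.norm_real, norm_norm] at this
    simp only [smul_apply, smul_eq_mul]
    linarith

end AbelAverage

/-! ### Cauchy estimates and continuous differentiability. -/

namespace AbelAverage

variable {X : Type*} [NormedAddCommGroup X] [NormedSpace ℂ X]

/-- Cauchy's estimate for the Fréchet derivative. -/
theorem norm_fderiv_le_of_norm_le {Y : Type*} [NormedAddCommGroup Y] [NormedSpace ℂ Y]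
    {f : X → Y} {x : X} {r C : ℝ} (hr : 0 < r)
    (hf : DifferentiableOn ℂ f (Metric.ball x r)) (hC : ∀ y ∈ Metric.ball x r, ‖f y‖ ≤ C) :
    ‖fderiv ℂ f x‖ ≤ 2 * C / r := by
  refine Complex.norm_fderiv_le_div_of_mapsTo_ball hf (fun y hy => ?_) hr
  rw [mem_closedBall_iff_norm]
  have h1 := hC y hy
  have h2 := hC x (Metric.mem_ball_self hr)
  linarith [norm_sub_le (f y) (f x)]

theorem lipschitz_of_norm_le {Y : Type*} [NormedAddCommGroup Y] [NormedSpace ℂ Y]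
    {f : X → Y} {c : X} {r R C : ℝ} (hrR : r < R)
    (hf : DifferentiableOn ℂ f (Metric.ball c R)) (hC : ∀ y ∈ Metric.ball c R, ‖f y‖ ≤ C)
    {x y : X} (hx : x ∈ Metric.ball c r) (hy : y ∈ Metric.ball c r) :
    ‖f x - f y‖ ≤ 2 * C / (R - r) * ‖x - y‖ := by
  have hs : ∀ z ∈ Metric.ball c r, Metric.ball z (R - r) ⊆ Metric.ball c R := by
    intro z hz
    refine Metric.ball_subset_ball' ?_
    rw [Metric.mem_ball] at hz; linarith
  have hd : ∀ z ∈ Metric.ball c r, DifferentiableAt ℂ f z := fun z hz =>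
    (hf z (Metric.ball_subset_ball hrR.le hz)).differentiableAt
      (Metric.isOpen_ball.mem_nhds (Metric.ball_subset_ball hrR.le hz))
  refine (convex_ball c r).norm_image_sub_le_of_norm_fderiv_le hd (fun z hz => ?_) hy hx
  exact norm_fderiv_le_of_norm_le (by linarith) (hf.mono (hs z hz)) fun w hw => hC w (hs z hz hw)

/-- A holomorphic map between complex normed spaces is continuously differentiable. -/
theorem continuousAt_fderiv {f : X → X} {U : Set X} (hU : IsOpen U) (hf : DifferentiableOn ℂ f U)
    {x : X} (hx : x ∈ U) : ContinuousAt (fderiv ℂ f) x := by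
  have hd : ∀ z ∈ U, DifferentiableAt ℂ f z := fun z hz =>
    (hf z hz).differentiableAt (hU.mem_nhds hz)
  obtain ⟨R, hR, hRU, hRC⟩ : ∃ R > 0, Metric.ball x R ⊆ U ∧
      ∀ y ∈ Metric.ball x R, ‖f y‖ ≤ ‖f x‖ + 1 := by
    have h1 : ∀ᶠ y in 𝓝 x, y ∈ U ∧ ‖f y‖ ≤ ‖f x‖ + 1 := by
      refine Filter.Eventually.and (hU.mem_nhds hx) ?_
      have := (hd x hx).continuousAt.norm.eventually (Iio_mem_nhds (lt_add_one ‖f x‖))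
      filter_upwards [this] with y hy using le_of_lt hy
    obtain ⟨R, hR, h⟩ := Metric.eventually_nhds_iff_ball.1 h1
    exact ⟨R, hR, fun y hy => (h y hy).1, fun y hy => (h y hy).2⟩
  set L := 2 * (‖f x‖ + 1) / (R - R / 2) with hL
  have hL0 : 0 ≤ L := by
    have : 0 < R - R / 2 := by linarith
    positivity
  rw [Metric.continuousAt_iff']
  intro ε hε
  have hlim : ∀ᶠ y in 𝓝 x, 2 * (L * ‖y - x‖) / (R / 4) < ε := by
    have : Tendsto (fun y => 2 * (L * ‖y - x‖) / (R / 4)) (𝓝 x)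
        (𝓝 (2 * (L * ‖x - x‖) / (R / 4))) := by
      refine Continuous.tendsto ?_ x
      fun_prop
    simp only [sub_self, norm_zero, mul_zero, zero_div] at this
    exact this.eventually (Iio_mem_nhds hε)
  filter_upwards [hlim, Metric.ball_mem_nhds x (show 0 < R / 4 by linarith)] with y hy hyR
  rw [mem_ball_iff_norm] at hyR
  refine lt_of_le_of_lt ?_ hy
  -- The difference of derivatives is the derivative at `x` of one function, the increment of `f` by
  -- `y - x`. That increment is uniformly small because `f` is Lipschitz, so Cauchy's estimate
  -- applies to it.
  have e1 : fderiv ℂ (fun z => f (z + (y - x)) - f z) x = fderiv ℂ f y - fderiv ℂ f x := by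
    have hy' : DifferentiableAt ℂ f (x + (y - x)) := by
      rw [add_sub_cancel]
      exact hd y (hRU (by rw [mem_ball_iff_norm]; linarith))
    have hc : DifferentiableAt ℂ (fun z => f (z + (y - x))) x :=
      hy'.comp (f := fun z => z + (y - x)) x (by fun_prop)
    rw [fderiv_fun_sub hc (hd x hx), fderiv_comp_add_right, add_sub_cancel]
  rw [dist_eq_norm, ← e1]
  have hb : ∀ z ∈ Metric.ball x (R / 4), z ∈ Metric.ball x (R / 2) ∧
      z + (y - x) ∈ Metric.ball x (R / 2) := by
    intro z hz
    simp only [mem_ball_iff_norm] at hz ⊢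
    refine ⟨by linarith, ?_⟩
    have : z + (y - x) - x = (z - x) + (y - x) := by abel
    rw [this]
    linarith [norm_add_le (z - x) (y - x)]
  have hsub : Metric.ball x (R / 2) ⊆ U :=
    (Metric.ball_subset_ball (by linarith)).trans hRU
  refine norm_fderiv_le_of_norm_le (by linarith) ?_ ?_
  · refine DifferentiableOn.sub ?_ (hf.mono fun z hz => hsub (hb z hz).1)
    exact (hf.comp (f := fun z => z + (y - x)) (by fun_prop)
      fun z hz => hsub (hb z hz).2)
  · intro z hz
    refine (lipschitz_of_norm_le (by linarith) (hf.mono hRU) hRC (hb z hz).2 (hb z hz).1).trans ?_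
    rw [add_sub_cancel_left]

/-- Strict differentiability is the form needed by the inverse function theorem and by the local
Lipschitz bound. -/
theorem hasStrictFDerivAt {f : X → X} {U : Set X} (hU : IsOpen U) (hf : DifferentiableOn ℂ f U)
    {x : X} (hx : x ∈ U) : HasStrictFDerivAt f (fderiv ℂ f x) x :=
  hasStrictFDerivAt_of_hasFDerivAt_of_continuousAt
    (by
      filter_upwards [hU.mem_nhds hx] with z hz
      exact ((hf z hz).differentiableAt (hU.mem_nhds hz)).hasFDerivAt)
    (continuousAt_fderiv hU hf hx)

/-! ### The Earle–Hamilton fixed point theorem. -/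

section EarleHamilton

variable {f : X → X} {s s' : ℝ}

/-- The derivatives of the iterates of a holomorphic map of a ball strictly into itself decay
geometrically. -/
theorem norm_fderiv_iterate_le (hs : s' < s)
    (hf : DifferentiableOn ℂ f (Metric.ball 0 s))
    (hm : MapsTo f (Metric.ball 0 s) (Metric.closedBall 0 s')) {t : ℝ} (ht : 0 < t)
    (hts : s' + t * (2 * s') < s) {y : X} (hy : y ∈ Metric.closedBall (0 : X) s') (n : ℕ) :
    DifferentiableAt ℂ f^[n] y ∧
      ‖fderiv ℂ f^[n] y‖ ≤ 2 * s / (s - s') * ((1 + t)⁻¹) ^ n := by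
  have hcl : Metric.closedBall (0 : X) s' ⊆ Metric.ball 0 s := Metric.closedBall_subset_ball hs
  have horb : ∀ n, f^[n] y ∈ Metric.closedBall (0 : X) s' := by
    intro n
    induction n with
    | zero => exact hy
    | succ n ih => rw [Function.iterate_succ_apply']; exact hm (hcl ih)
  have hd : ∀ z ∈ Metric.ball (0 : X) s, DifferentiableAt ℂ f z := fun z hz =>
    (hf z hz).differentiableAt (Metric.isOpen_ball.mem_nhds hz)
  have key : ∀ n, ∃ F : X → X, DifferentiableOn ℂ F (Metric.ball 0 s) ∧
      MapsTo F (Metric.ball 0 s) (Metric.ball 0 s) ∧ F y = f^[n] y ∧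
      DifferentiableAt ℂ f^[n] y ∧
      fderiv ℂ F y = ((1 + t : ℝ) : ℂ) ^ n • fderiv ℂ f^[n] y := by
    intro n
    induction n with
    | zero =>
      exact ⟨id, differentiableOn_id, mapsTo_id _, rfl, differentiableAt_id, by simp⟩
    | succ n ih =>
      obtain ⟨F, h1, h2, h3, h4, h5⟩ := ih
      set a := f^[n] y with ha
      have hab : a ∈ Metric.ball (0 : X) s := hcl (horb n)
      set G : X → X := fun z => f z + (t : ℂ) • (f z - f a) with hG
      have hGd : DifferentiableOn ℂ G (Metric.ball 0 s) := by fun_prop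
      have hGm : MapsTo G (Metric.ball 0 s) (Metric.ball 0 s) := by
        intro z hz
        have e1 := hm hz
        have e2 := hm hab
        simp only [mem_closedBall_zero_iff, mem_ball_zero_iff] at e1 e2 ⊢
        calc ‖G z‖ ≤ ‖f z‖ + ‖(t : ℂ) • (f z - f a)‖ := norm_add_le _ _
          _ = ‖f z‖ + t * ‖f z - f a‖ := by rw [norm_smul]; simp [abs_of_pos ht]
          _ ≤ s' + t * (2 * s') := by
            gcongr
            linarith [norm_sub_le (f z) (f a)]
          _ < s := hts
      have hFy : DifferentiableAt ℂ F y :=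
        (h1 y (hcl hy)).differentiableAt (Metric.isOpen_ball.mem_nhds (hcl hy))
      have hGF : HasFDerivAt G (((1 + t : ℝ) : ℂ) • fderiv ℂ f a) (F y) := by
        rw [h3]
        have := ((hd a hab).hasFDerivAt).add
          ((((hd a hab).hasFDerivAt).sub_const (f a)).const_smul (t : ℂ))
        refine this.congr_fderiv ?_
        push_cast
        rw [add_smul, one_smul]
      have hfa : HasFDerivAt f^[n + 1] ((fderiv ℂ f a).comp (fderiv ℂ f^[n] y)) y := by
        rw [Function.iterate_succ']
        exact (hd a hab).hasFDerivAt.comp y h4.hasFDerivAt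
      refine ⟨G ∘ F, hGd.comp h1 h2, hGm.comp h2, ?_, hfa.differentiableAt, ?_⟩
      · simp only [Function.comp, h3, hG, Function.iterate_succ_apply']
        simp [ha]
      · rw [(hGF.comp y hFy.hasFDerivAt).fderiv, h5, hfa.fderiv, pow_succ']
        ext v
        simp only [ContinuousLinearMap.comp_apply, smul_apply, mul_smul, map_smul]
        rw [smul_comm]
  obtain ⟨F, h1, h2, h3, h4, h5⟩ := key n
  refine ⟨h4, ?_⟩
  have hsub : Metric.ball y (s - s') ⊆ Metric.ball (0 : X) s := by
    refine Metric.ball_subset_ball' ?_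
    rw [Metric.mem_closedBall] at hy; linarith
  have := norm_fderiv_le_of_norm_le (C := s) (sub_pos.2 hs) (h1.mono hsub)
    (fun z hz => by simpa using (mem_ball_zero_iff.1 (h2 (hsub hz))).le)
  rw [h5, norm_smul, norm_pow, Complex.norm_real, Real.norm_eq_abs,
    abs_of_pos (by linarith : 0 < 1 + t)] at this
  rw [inv_pow, ← div_eq_mul_inv, le_div_iff₀ (by positivity)]
  linarith

/-- The **Earle–Hamilton theorem** for balls, with the invertibility of `1 - f'` at the fixed
point. -/
theorem existsUnique_fixedPoint [CompleteSpace X] (hs' : 0 ≤ s') (hs : s' < s)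
    (hf : DifferentiableOn ℂ f (Metric.ball 0 s))
    (hm : MapsTo f (Metric.ball 0 s) (Metric.closedBall 0 s')) :
    ∃ y ∈ Metric.closedBall (0 : X) s', f y = y ∧ (∀ z ∈ Metric.ball (0 : X) s, f z = z → z = y) ∧
      IsUnit (1 - fderiv ℂ f y) := by
  have hcl : Metric.closedBall (0 : X) s' ⊆ Metric.ball 0 s := Metric.closedBall_subset_ball hs
  obtain ⟨t, ht, hts⟩ : ∃ t > 0, s' + t * (2 * s') < s := by
    refine ⟨(s - s') / (2 * s' + 1), div_pos (by linarith) (by linarith), ?_⟩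
    have : (s - s') / (2 * s' + 1) * (2 * s') < s - s' := by
      rw [div_mul_eq_mul_div, div_lt_iff₀ (by linarith)]
      nlinarith
    linarith
  have hD := fun y (hy : y ∈ Metric.closedBall (0 : X) s') n =>
    norm_fderiv_iterate_le hs hf hm ht hts hy n
  obtain ⟨n, hn0, hn⟩ : ∃ n : ℕ, n ≠ 0 ∧ 2 * s / (s - s') * ((1 + t)⁻¹) ^ n < 1 / 2 := by
    have h1 : Tendsto (fun n : ℕ => 2 * s / (s - s') * ((1 + t)⁻¹) ^ n) atTop
        (𝓝 (2 * s / (s - s') * 0)) :=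
      (tendsto_pow_atTop_nhds_zero_of_lt_one (by positivity)
        (inv_lt_one_of_one_lt₀ (by linarith))).const_mul _
    rw [mul_zero] at h1
    exact ((eventually_ne_atTop 0).and (h1.eventually (Iio_mem_nhds (by norm_num)))).exists
  have hmaps : MapsTo f (Metric.closedBall (0 : X) s') (Metric.closedBall 0 s') :=
    hm.mono_left hcl
  have hmapsn := hmaps.iterate n
  have hlip : LipschitzOnWith (1 / 2) f^[n] (Metric.closedBall (0 : X) s') := by
    refine (convex_closedBall (0 : X) s').lipschitzOnWith_of_nnnorm_fderiv_le (𝕜 := ℂ)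
      (fun z hz => (hD z hz n).1) (fun z hz => ?_)
    have := ((hD z hz n).2.trans_lt hn).le
    exact_mod_cast this
  have hcontr : ContractingWith (1 / 2) (hmapsn.restrict f^[n] _ _) :=
    ⟨by
      rw [← NNReal.coe_lt_coe]; norm_num, hlip.mapsToRestrict hmapsn⟩
  obtain ⟨y, hy, hyn, -, -⟩ := hcontr.exists_fixedPoint' Metric.isClosed_closedBall.isComplete
    hmapsn (x := 0) (by simpa using hs') (edist_ne_top _ _)
  have huniq : ∀ z ∈ Metric.closedBall (0 : X) s', f^[n] z = z → z = y := by
    intro z hz hzn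
    have h1 := hlip.dist_le_mul z hz y hy
    rw [hzn, hyn.eq] at h1
    have h2 : ((1 / 2 : NNReal) : ℝ) = 1 / 2 := by norm_num
    rw [h2] at h1
    exact dist_le_zero.1 (by linarith [dist_nonneg (x := z) (y := y)])
  -- `f y` is also fixed by `f^[n]`, hence equals `y`.
  have hfy : f y = y := by
    refine huniq _ (hmaps hy) ?_
    rw [← Function.iterate_succ_apply, Function.iterate_succ_apply', hyn.eq]
  refine ⟨y, hy, hfy, fun z hz hzz => ?_, ?_⟩
  · refine huniq z ?_ (Function.iterate_fixed hzz n)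
    rw [← hzz]; exact hm hz
  · have hfd : HasFDerivAt f (fderiv ℂ f y) y :=
      ((hf y (hcl hy)).differentiableAt (Metric.isOpen_ball.mem_nhds (hcl hy))).hasFDerivAt
    have hpow : fderiv ℂ f^[n] y = (fderiv ℂ f y) ^ n := (hfd.iterate hfy n).fderiv
    have hu : IsUnit (1 - (fderiv ℂ f y) ^ n) := by
      refine isUnit_one_sub_of_norm_lt_one ?_
      rw [← hpow]
      linarith [(hD y hy n).2]
    -- `1 - Aⁿ` is invertible and equals `(1 - A) * ∑ Aⁱ`; the factors commute, so `1 - A` is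
    -- invertible too.
    rw [← mul_neg_geom_sum] at hu
    have hc : Commute (1 - fderiv ℂ f y) (∑ i ∈ Finset.range n, fderiv ℂ f y ^ i) := by
      refine Commute.sub_left (Commute.one_left _) ?_
      exact Commute.sum_right _ _ _ fun i _ => (Commute.refl _).pow_right i
    exact (hc.isUnit_mul_iff.1 hu).1

end EarleHamilton

end AbelAverage

/-! ### Solving `y - g y = x` in the ball. -/

namespace AbelAverage

variable {X : Type*} [NormedAddCommGroup X] [NormedSpace ℂ X]

theorem HasUnitRadiusOfBoundedness.exists_bound {Y : Type*} [NormedAddCommGroup Y] {g : Y → Y} (h : HasUnitRadiusOfBoundedness g)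
    {r : ℝ} (hr : r < 1) : ∃ C : ℝ, 0 ≤ C ∧ ∀ x, ‖x‖ ≤ r → ‖g x‖ ≤ C := by
  obtain ⟨C, hC⟩ := h (max r (1 / 2)) (by positivity) (max_lt hr (by norm_num))
  refine ⟨max C 0, le_max_right _ _, fun x hx => (hC x ?_).trans (le_max_left _ _)⟩
  rw [mem_closedBall_zero_iff]
  exact hx.trans (le_max_left _ _)

/-- One small Euler step for the equation `y - g y = x` maps a large ball strictly into itself. -/
theorem exists_mapsTo_closedBall {g : X → X} (hg : DifferentiableOn ℂ g (Metric.ball 0 1))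
    (hb : HasUnitRadiusOfBoundedness g) {M : ℝ} (hM : 0 ≤ M)
    (hd : ∀ z : X, ‖z‖ < 1 → ∀ φ ∈ dualityMap z, (φ (g z)).re ≤ M * ‖z‖ * (1 - ‖z‖ ^ 2))
    {x : X} {s : ℝ} (hs0 : 0 < s) (hs1 : s < 1) (hxs : ‖x‖ + M * (1 - s ^ 2) < s) :
    ∃ ε : ℝ, 0 < ε ∧ ∃ s', 0 ≤ s' ∧ s' < s ∧
      MapsTo (fun y => y + (ε : ℂ) • (x + g y - y)) (Metric.ball 0 s) (Metric.closedBall 0 s') := by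
  -- Nested radii `s < s₁ < R < 1`: start points lie in the first ball, their images in the second
  -- where `w` is Lipschitz, and `w` is bounded on the third.
  set s₁ := s + (1 - s) / 3 with hs₁
  set R := s + 2 * (1 - s) / 3 with hR
  obtain ⟨C, hC0, hC⟩ := hb.exists_bound (show R < 1 by linarith)
  set w : X → X := fun y => x + g y - y with hw
  set K := ‖x‖ + C + 1 with hK
  have hK0 : 0 < K := by positivity
  have hwK : ∀ y ∈ Metric.ball (0 : X) R, ‖w y‖ ≤ K := by
    intro y hy
    rw [mem_ball_zero_iff] at hy
    calc ‖w y‖ ≤ ‖x + g y‖ + ‖y‖ := norm_sub_le _ _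
      _ ≤ ‖x‖ + ‖g y‖ + ‖y‖ := by gcongr; exact norm_add_le _ _
      _ ≤ K := by linarith [hC y hy.le]
  have hwd : DifferentiableOn ℂ w (Metric.ball 0 R) := by
    have := hg.mono (Metric.ball_subset_ball (show R ≤ 1 by linarith))
    fun_prop
  set L := 2 * K / (R - s₁) with hL
  have hL0 : 0 ≤ L := div_nonneg (by positivity) (by linarith)
  have hlip : ∀ y z : X, ‖y‖ < s₁ → ‖z‖ < s₁ → ‖w y - w z‖ ≤ L * ‖y - z‖ := fun y z hy hz =>
    lipschitz_of_norm_le (by linarith) hwd hwK (by simpa using hy) (by simpa using hz)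
  -- The slack in `hxs` is `4 * c`. One `c` pays for the shrinking of `s` to `s - ε * c` and less
  -- than another for the errors of second order in `ε`, collected in `B`.
  obtain ⟨c, hc0, hc⟩ : ∃ c > 0, ‖x‖ + M * (1 - s ^ 2) + 4 * c = s :=
    ⟨(s - ‖x‖ - M * (1 - s ^ 2)) / 4, by linarith, by ring⟩
  set B := L * K + c + 2 * M * c with hB
  have hB0 : 0 < B := by positivity
  obtain ⟨ε, hε, h1, h2, h3⟩ : ∃ ε > 0, ε * K < s₁ - s ∧ ε * B < c ∧ ε * c < s := by
    have hev : ∀ A a : ℝ, 0 < a → ∀ᶠ ε : ℝ in 𝓝[>] 0, ε * A < a := by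
      intro A a ha
      have : Tendsto (fun ε : ℝ => ε * A) (𝓝[>] 0) (𝓝 (0 * A)) :=
        (Continuous.tendsto (by fun_prop) _).mono_left nhdsWithin_le_nhds
      rw [zero_mul] at this
      exact this.eventually (Iio_mem_nhds ha)
    obtain ⟨ε, ⟨⟨ha, hb⟩, hc⟩, hd⟩ := (((hev K (s₁ - s) (by linarith)).and (hev B c hc0)).and
      (hev c s hs0)).and self_mem_nhdsWithin |>.exists
    exact ⟨ε, hd, ha, hb, hc⟩
  refine ⟨ε, hε, s - ε * c, by linarith, by nlinarith, fun y hy => ?_⟩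
  rw [mem_ball_zero_iff] at hy
  rw [mem_closedBall_zero_iff]
  by_contra! hcon
  set z := y + (ε : ℂ) • w y with hz
  change s - ε * c < ‖z‖ at hcon
  have hwy := hwK y (by rw [mem_ball_zero_iff]; linarith)
  have hεn : ‖(ε : ℂ)‖ = ε := by simp [abs_of_pos hε]
  have hzy : ‖z - y‖ ≤ ε * K := by
    rw [hz, add_sub_cancel_left, norm_smul, hεn]; gcongr
  have hz1 : ‖z‖ < s₁ := by
    have := norm_add_le (z - y) y
    rw [sub_add_cancel] at this; linarith
  -- The functional is taken at the image `z`, not at `y`: up to order `ε²` the step is implicit, `z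
  -- - ε w(z) ≈ y`, and (E) at `z` bounds Re φ(w z) from above. If `z` were outside the smaller
  -- ball, the two estimates of Re φ(z - ε w(z)) would be incompatible.
  obtain ⟨φ, hφ⟩ := dualityMap_nonempty z
  have hφn := norm_of_mem_dualityMap hφ
  have hz0 : 0 < ‖z‖ := by linarith
  have e1 : (φ (w z)).re ≤ ‖z‖ * ‖x‖ + M * ‖z‖ * (1 - ‖z‖ ^ 2) - ‖z‖ ^ 2 := by
    have a1 : (φ x).re ≤ ‖z‖ * ‖x‖ :=
      (Complex.re_le_norm _).trans (by rw [← hφn]; exact φ.le_opNorm x)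
    have a2 := hd z (by linarith) φ hφ
    have a3 : (φ z).re = ‖z‖ ^ 2 := by rw [hφ.1, Complex.ofReal_re]
    have a4 : φ (w z) = φ x + φ (g z) - φ z := by rw [hw, map_sub, map_add]
    rw [a4, Complex.sub_re, Complex.add_re]
    linarith
  clear_value z w K L B s₁ R
  have e2 : ‖z - (ε : ℂ) • w z‖ ≤ s + ε * (L * (ε * K)) := by
    have : z - (ε : ℂ) • w z = y + (ε : ℂ) • (w y - w z) := by
      rw [smul_sub, ← add_sub_assoc, ← hz]
    rw [this]
    refine (norm_add_le _ _).trans ?_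
    rw [norm_smul, hεn]
    have hl := hlip y z (by linarith) hz1
    rw [norm_sub_rev y z] at hl
    gcongr
    exact hl.trans (by gcongr)
  have e3 : ‖z‖ ^ 2 - ε * (φ (w z)).re ≤ ‖z‖ * (s + ε * (L * (ε * K))) := by
    have a1 : (φ (z - (ε : ℂ) • w z)).re = ‖z‖ ^ 2 - ε * (φ (w z)).re := by
      rw [map_sub, map_smul, hφ.1, Complex.sub_re, Complex.ofReal_re, smul_eq_mul,
        Complex.re_ofReal_mul]
    rw [← a1]
    refine (Complex.re_le_norm _).trans ((φ.le_opNorm _).trans ?_)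
    rw [hφn]; gcongr
  have e4 : ‖z‖ * (1 + ε) ≤ s + ε * (L * (ε * K)) + ε * ‖x‖ + ε * (M * (1 - ‖z‖ ^ 2)) := by
    refine le_of_mul_le_mul_left ?_ hz0
    have := mul_le_mul_of_nonneg_left e1 hε.le
    linarith
  have e5 : s ^ 2 - 2 * c * ε ≤ ‖z‖ ^ 2 := by
    have : (s - ε * c) ^ 2 ≤ ‖z‖ ^ 2 := by gcongr
    nlinarith [mul_nonneg (mul_pos hε hc0).le (sub_nonneg.2 hs1.le), sq_nonneg (ε * c)]
  have e6 : M * (1 - ‖z‖ ^ 2) ≤ M * (1 - s ^ 2) + 2 * M * c * ε := by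
    nlinarith [mul_le_mul_of_nonneg_left e5 hM]
  have e7 : (s - ε * c) * (1 + ε) ≤
      s + ε * (L * (ε * K)) + ε * ‖x‖ + ε * (M * (1 - s ^ 2) + 2 * M * c * ε) :=
    le_trans (by gcongr) (e4.trans (by gcongr))
  have e8 : s ≤ c + ε * B + (‖x‖ + M * (1 - s ^ 2)) := by
    refine le_of_mul_le_mul_left ?_ hε
    rw [hB]
    linarith
  linarith

theorem eventually_norm_add_lt {Y : Type*} [NormedAddCommGroup Y] {M : ℝ} {x : Y} (hx : ‖x‖ < 1) :
    ∀ᶠ s : ℝ in 𝓝[<] 1, ‖x‖ + M * (1 - s ^ 2) < s := by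
  have h : Tendsto (fun s : ℝ => s - (‖x‖ + M * (1 - s ^ 2))) (𝓝[<] 1)
      (𝓝 (1 - (‖x‖ + M * (1 - 1 ^ 2)))) :=
    (Continuous.tendsto (by fun_prop) _).mono_left nhdsWithin_le_nhds
  filter_upwards [h.eventually (lt_mem_nhds (show 0 < _ by linarith))] with s hs
  linarith

variable [CompleteSpace X]

/-- The Euler step has the solutions as fixed points and derivative `1 + ε (g' - 1)`, so
Earle–Hamilton on a ball of radius `s` near 1 gives all the claims there, including invertibility of
`1 - g'`. -/
theorem existsUnique_sub_eq {g : X → X} (hg : DifferentiableOn ℂ g (Metric.ball 0 1))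
    (hb : HasUnitRadiusOfBoundedness g) {M : ℝ} (hM : 0 ≤ M)
    (hd : ∀ z : X, ‖z‖ < 1 → ∀ φ ∈ dualityMap z, (φ (g z)).re ≤ M * ‖z‖ * (1 - ‖z‖ ^ 2))
    {x : X} (hx : ‖x‖ < 1) :
    ∃ y : X, ‖y‖ < 1 ∧ y - g y = x ∧ (∀ z : X, ‖z‖ < 1 → z - g z = x → z = y) ∧
      IsUnit (1 - fderiv ℂ g y) := by
  have key : ∀ s, 0 < s → s < 1 → ‖x‖ + M * (1 - s ^ 2) < s →
      ∃ y : X, ‖y‖ < s ∧ y - g y = x ∧ (∀ z : X, ‖z‖ < s → z - g z = x → z = y) ∧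
      IsUnit (1 - fderiv ℂ g y) := by
    intro s hs0 hs1 hs
    obtain ⟨ε, hε, s', hs'0, hs', hmap⟩ := exists_mapsTo_closedBall hg hb hM hd hs0 hs1 hs
    have hε0 : (ε : ℂ) ≠ 0 := by simpa using hε.ne'
    have hgs := hg.mono (Metric.ball_subset_ball hs1.le)
    obtain ⟨y, hy, hfy, huniq, hunit⟩ := existsUnique_fixedPoint hs'0 hs' (by fun_prop) hmap
    have hys : ‖y‖ < s := (mem_closedBall_zero_iff.1 hy).trans_lt hs'
    have hfix : ∀ z : X, z + (ε : ℂ) • (x + g z - z) = z ↔ z - g z = x := by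
      intro z
      rw [add_eq_left, smul_eq_zero, or_iff_right hε0, sub_eq_zero]
      exact eq_comm.trans sub_eq_iff_eq_add.symm
    refine ⟨y, hys, (hfix y).1 hfy, fun z hz hzx =>
      huniq z (mem_ball_zero_iff.2 hz) ((hfix z).2 hzx), ?_⟩
    have hgy : HasFDerivAt g (fderiv ℂ g y) y :=
      ((hgs y (mem_ball_zero_iff.2 hys)).differentiableAt
        (Metric.isOpen_ball.mem_nhds (mem_ball_zero_iff.2 hys))).hasFDerivAt
    have hD : fderiv ℂ (fun y => y + (ε : ℂ) • (x + g y - y)) y =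
        1 + (ε : ℂ) • (fderiv ℂ g y - 1) :=
      ((hasFDerivAt_id y).add (((hgy.const_add x).sub (hasFDerivAt_id y)).const_smul _)).fderiv
    rw [hD] at hunit
    have e : 1 - fderiv ℂ g y = algebraMap ℂ (X →L[ℂ] X) (ε : ℂ)⁻¹ *
        (1 - (1 + (ε : ℂ) • (fderiv ℂ g y - 1))) := by
      rw [← Algebra.smul_def, sub_add_cancel_left, ← smul_neg, inv_smul_smul₀ hε0, neg_sub]
    rw [e]
    exact ((IsUnit.mk0 _ (inv_ne_zero hε0)).map _).mul hunit
  obtain ⟨s, hs, hs01⟩ := ((eventually_norm_add_lt (M := M) hx).and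
    (Ioo_mem_nhdsLT (zero_lt_one' ℝ))).exists
  obtain ⟨y, hy, hyx, -, hu⟩ := key s hs01.1 hs01.2 hs
  refine ⟨y, hy.trans hs01.2, hyx, fun z hz hzx => ?_, hu⟩
  -- Any two solutions lie in a common ball of radius `r < 1` on which uniqueness is already known.
  obtain ⟨r, hr, hr1⟩ := ((eventually_norm_add_lt (M := M) hx).and
    (Ioo_mem_nhdsLT (max_lt hz (hy.trans hs01.2)))).exists
  have hzr := (le_max_left _ _).trans_lt hr1.1
  obtain ⟨y', -, -, huniq, -⟩ := key r ((norm_nonneg z).trans_lt hzr) hr1.2 hr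
  rw [huniq z hzr hzx, huniq y ((le_max_right _ _).trans_lt hr1.1) hyx]

/-- The resolvent `(I - g)⁻¹` is holomorphic. -/
theorem differentiableOn_of_sub_eq {g Φ : X → X} (hg : DifferentiableOn ℂ g (Metric.ball 0 1))
    (hΦ : ∀ x ∈ Metric.ball (0 : X) 1, Φ x ∈ Metric.ball (0 : X) 1 ∧ Φ x - g (Φ x) = x ∧
      (∀ z ∈ Metric.ball (0 : X) 1, z - g z = x → z = Φ x) ∧ IsUnit (1 - fderiv ℂ g (Φ x))) :
    DifferentiableOn ℂ Φ (Metric.ball 0 1) := by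
  intro x hx
  obtain ⟨h1, h2, -, u, hu⟩ := hΦ x hx
  refine DifferentiableAt.differentiableWithinAt ?_
  have hF : HasStrictFDerivAt (fun y => y - g y)
      (ContinuousLinearEquiv.unitsEquiv ℂ X u : X →L[ℂ] X) (Φ x) := by
    refine ((hasStrictFDerivAt_id (Φ x)).sub
      (hasStrictFDerivAt Metric.isOpen_ball hg h1)).congr_fderiv ?_
    ext v
    change v - fderiv ℂ g (Φ x) v = (u : X →L[ℂ] X) v
    rw [hu]
    rfl
  have hinv := hF.to_localInverse
  have hev := hF.eventually_right_inverse
  have hval := hF.localInverse_apply_image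
  simp only [h2] at hinv hev hval
  refine (hinv.hasFDerivAt.differentiableAt).congr_of_eventuallyEq ?_
  have hcont := hinv.hasFDerivAt.continuousAt.tendsto
  rw [hval] at hcont
  -- By continuity the local inverse takes values in the ball, where uniqueness identifies it with
  -- `Φ`.
  filter_upwards [hev, hcont.eventually (Metric.isOpen_ball.mem_nhds h1),
    Metric.isOpen_ball.mem_nhds hx] with x' ha hb' hc
  exact ((hΦ x' hc).2.2.1 _ hb' ha).symm

end AbelAverage

/-! ### Norm bounds from numerical range bounds. -/

namespace AbelAverage

variable {X : Type*} [NormedAddCommGroup X] [NormedSpace ℂ X]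

/-- A holomorphic function whose numerical range over a ball is bounded by `V` satisfies a norm
estimate on smaller balls that depends on `V` only. -/
theorem norm_le_of_numericalRange_le {f : X → X} {R K V ρ T : ℝ}
    (hf : DifferentiableOn ℂ f (Metric.ball 0 R)) (hK : ∀ z ∈ Metric.ball (0 : X) R, ‖f z‖ ≤ K)
    (hV : ∀ z : X, ‖z‖ < R → ∀ φ ∈ dualityMap z, ‖φ (f z)‖ ≤ V * ‖z‖) (hρR : ρ < R)
    (hT : 0 < T) (hV0 : 0 ≤ V) {x : X} (hx : ‖x‖ + T * V < ρ) : ‖f x‖ ≤ 2 * ρ / T := by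
  have hρ0 : 0 < ρ := by
    have : 0 ≤ T * V := by positivity
    linarith [norm_nonneg x]
  have hK0 : 0 ≤ K := (norm_nonneg _).trans (hK 0 (Metric.mem_ball_self (hρ0.trans hρR)))
  obtain ⟨R', hρR', hR'R⟩ := exists_between hρR
  set L := 2 * K / (R - R') with hL
  have hL0 : 0 ≤ L := div_nonneg (by positivity) (by linarith)
  have hlip : ∀ y z : X, ‖y‖ < R' → ‖z‖ < R' → ‖f y - f z‖ ≤ L * ‖y - z‖ := fun y z hy hz =>
    lipschitz_of_norm_le hR'R hf hK (by simpa using hy) (by simpa using hz)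
  clear_value L
  obtain ⟨N, hN0, hN1, hN2⟩ : ∃ N : ℕ, 0 < N ∧ T / N * K < R' - ρ ∧
      ‖x‖ + T * V + T * (T / N * (L * K)) < ρ := by
    have h0 : Tendsto (fun N : ℕ => T / (N : ℝ)) atTop (𝓝 0) :=
      tendsto_const_div_atTop_nhds_zero_nat T
    have h1 := h0.mul_const K
    have h2 := ((h0.mul_const (L * K)).const_mul T).const_add (‖x‖ + T * V)
    simp only [zero_mul, mul_zero, add_zero] at h1 h2
    obtain ⟨N, ⟨ha, hb⟩, hc⟩ := (((h1.eventually (gt_mem_nhds (sub_pos.2 hρR'))).and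
      (h2.eventually (gt_mem_nhds hx))).and (eventually_gt_atTop 0)).exists
    exact ⟨N, hc, ha, hb⟩
  have hN0' : (0 : ℝ) < N := by exact_mod_cast hN0
  set τ := T / N with hτ
  have hτ0 : 0 < τ := by positivity
  have hNτ : N * τ = T := by rw [hτ]; field_simp
  clear_value τ
  -- An Euler step with complex step size increases the norm by at most `τ * V` up to order `τ²`;
  -- the a priori bound `K` enters only the error, which vanishes as `N → ∞`.
  have step : ∀ (y : X) (ε : ℂ), ‖y‖ < ρ → ‖ε‖ < τ →
      ‖y + ε • f y‖ ≤ ‖y‖ + (τ * V + τ * (τ * (L * K))) := by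
    intro y ε hy hε
    set z := y + ε • f y with hz
    rcases eq_or_ne z 0 with h0 | h0
    · rw [h0, norm_zero]; positivity
    have hz0 : 0 < ‖z‖ := norm_pos_iff.2 h0
    have hfy : ‖f y‖ ≤ K := hK y (by rw [mem_ball_zero_iff]; linarith)
    have hzy : ‖z - y‖ ≤ τ * K := by
      rw [hz, add_sub_cancel_left, norm_smul]; gcongr
    have hzR : ‖z‖ < R' := by
      have := norm_add_le (z - y) y
      rw [sub_add_cancel] at this; linarith
    obtain ⟨φ, hφ⟩ := dualityMap_nonempty z
    have e0 : ‖z - ε • f z‖ ≤ ‖y‖ + τ * (L * (τ * K)) := by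
      have : z - ε • f z = y + ε • (f y - f z) := by
        rw [smul_sub, ← add_sub_assoc, ← hz]
      rw [this]
      refine (norm_add_le _ _).trans ?_
      rw [norm_smul]
      have hl := hlip y z (by linarith) hzR
      rw [norm_sub_rev y z] at hl
      gcongr
      exact hl.trans (by gcongr)
    have e1 : ‖φ (z - ε • f z)‖ ≤ ‖z‖ * (‖y‖ + τ * (L * (τ * K))) := by
      refine (φ.le_opNorm _).trans ?_
      rw [norm_of_mem_dualityMap hφ]; gcongr
    have e2 : ‖z‖ ^ 2 - τ * (V * ‖z‖) ≤ ‖φ (z - ε • f z)‖ := by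
      have a1 : φ z = φ (z - ε • f z) + ε * φ (f z) := by
        rw [map_sub, map_smul, smul_eq_mul, sub_add_cancel]
      have a2 : ‖φ z‖ = ‖z‖ ^ 2 := by
        rw [hφ.1, Complex.norm_real, Real.norm_eq_abs, abs_of_nonneg (by positivity)]
      have a3 : ‖ε * φ (f z)‖ ≤ τ * (V * ‖z‖) := by
        rw [norm_mul]
        have := hV z (by linarith) φ hφ
        gcongr
      have a4 := norm_add_le (φ (z - ε • f z)) (ε * φ (f z))
      rw [← a1, a2] at a4
      linarith
    refine le_of_mul_le_mul_left ?_ hz0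
    linarith
  -- After `N` steps the Euler polygon is still in the ball of radius `ρ`. It is holomorphic in `ε`
  -- with derivative `N • f x` at `0`, so Cauchy's estimate on the disc of radius `τ = T / N` yields
  -- a bound free of `N` and `K`.
  set y : ℕ → ℂ → X := fun k ε => (fun p => p + ε • f p)^[k] x with hy
  have hy0 : ∀ ε, y 0 ε = x := fun _ => rfl
  have hys : ∀ k ε, y (k + 1) ε = y k ε + ε • f (y k ε) := fun k ε => by
    simp only [hy, Function.iterate_succ_apply']
  clear_value y
  have hbd : ∀ k ≤ N, ∀ ε : ℂ, ‖ε‖ < τ →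
      ‖y k ε‖ ≤ ‖x‖ + k * (τ * V + τ * (τ * (L * K))) ∧ ‖y k ε‖ < ρ := by
    intro k hk ε hε
    have aux : ∀ k ≤ N, ‖x‖ + k * (τ * V + τ * (τ * (L * K))) < ρ := by
      intro k hk
      refine lt_of_le_of_lt ?_ hN2
      have : (k : ℝ) ≤ N := by exact_mod_cast hk
      calc ‖x‖ + k * (τ * V + τ * (τ * (L * K))) ≤ ‖x‖ + N * (τ * V + τ * (τ * (L * K))) := by
            gcongr
        _ = ‖x‖ + (N * τ) * V + (N * τ) * (τ * (L * K)) := by ring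
        _ = _ := by rw [hNτ]
    induction k with
    | zero => exact ⟨by simp [hy0], by rw [hy0]; simpa using aux 0 hk⟩
    | succ k ih =>
      obtain ⟨h1, h2⟩ := ih (by omega)
      have h3 : ‖y (k + 1) ε‖ ≤ ‖x‖ + (k + 1 : ℕ) * (τ * V + τ * (τ * (L * K))) := by
        rw [hys]
        refine (step _ _ h2 hε).trans ?_
        push_cast
        linarith
      exact ⟨h3, h3.trans_lt (aux _ hk)⟩
  have hdf : ∀ z : X, ‖z‖ < ρ → DifferentiableAt ℂ f z := fun z hz =>
    (hf z (by rw [mem_ball_zero_iff]; linarith)).differentiableAt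
      (Metric.isOpen_ball.mem_nhds (by rw [mem_ball_zero_iff]; linarith))
  have hyd : ∀ k ≤ N, ∀ ε : ℂ, ‖ε‖ < τ → DifferentiableAt ℂ (y k) ε := by
    intro k hk ε hε
    induction k with
    | zero =>
      rw [show y 0 = fun _ => x from funext hy0]
      exact differentiableAt_const _
    | succ k ih =>
      have h1 := ih (by omega)
      rw [show y (k + 1) = fun ε => y k ε + ε • f (y k ε) from funext (hys k)]
      have h2 : DifferentiableAt ℂ (fun ε => f (y k ε)) ε :=
        (hdf _ (hbd k (by omega) ε hε).2).comp ε h1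
      exact h1.add (differentiableAt_id.smul h2)
  have hder : ∀ k ≤ N, y k 0 = x ∧ HasDerivAt (y k) ((k : ℂ) • f x) 0 := by
    intro k hk
    induction k with
    | zero =>
      refine ⟨hy0 0, ?_⟩
      rw [show y 0 = fun _ => x from funext hy0]
      simpa using hasDerivAt_const (0 : ℂ) x
    | succ k ih =>
      obtain ⟨h1, h2⟩ := ih (by omega)
      refine ⟨by rw [hys, h1]; simp, ?_⟩
      rw [show y (k + 1) = fun ε => y k ε + ε • f (y k ε) from funext (hys k)]
      have h3 : DifferentiableAt ℂ (fun ε => f (y k ε)) 0 :=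
        (hdf _ (hbd k (by omega) 0 (by simpa using hτ0)).2).comp 0 h2.differentiableAt
      have h4 := h2.add ((hasDerivAt_id (0 : ℂ)).smul h3.hasDerivAt)
      refine h4.congr_deriv ?_
      simp [h1, add_smul]
  have hfin := norm_fderiv_le_of_norm_le (f := y N) (x := 0) (C := ρ) hτ0
    (fun ε hε => (hyd N le_rfl ε (by simpa using hε)).differentiableWithinAt)
    (fun ε hε => (hbd N le_rfl ε (by simpa using hε)).2.le)
  rw [← norm_deriv_eq_norm_fderiv, (hder N le_rfl).2.deriv, norm_smul, Complex.norm_natCast,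
    le_div_iff₀ hτ0] at hfin
  rw [le_div_iff₀ hT, ← hNτ]
  linarith

/-! ### Homogeneous Taylor terms. -/

section TaylorTerm

variable {Y : Type*} [NormedAddCommGroup Y] [NormedSpace ℂ Y]

/-- The homogeneous term of degree `n` of the Taylor expansion of `g` at `0`. -/
noncomputable def taylorTerm (g : X → Y) (n : ℕ) (x : X) : Y :=
  (n.factorial : ℂ)⁻¹ • iteratedDeriv n (fun ζ : ℂ => g (ζ • x)) 0

theorem iteratedDeriv_comp_mul_left (f : ℂ → Y) (c : ℂ) (n : ℕ) (z : ℂ) :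
    iteratedDeriv n (fun ζ => f (c * ζ)) z = c ^ n • iteratedDeriv n f (c * z) := by
  induction n generalizing z with
  | zero => simp
  | succ n ih =>
    rw [iteratedDeriv_succ, iteratedDeriv_succ, funext ih, deriv_fun_const_smul_field,
      deriv_comp_mul_left c (iteratedDeriv n f) z, smul_smul, pow_succ]

theorem taylorTerm_smul (g : X → Y) (n : ℕ) (c : ℂ) (x : X) :
    taylorTerm g n (c • x) = c ^ n • taylorTerm g n x := by
  have : (fun ζ : ℂ => g (ζ • c • x)) = fun ζ => (fun ζ : ℂ => g (ζ • x)) (c * ζ) := by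
    funext ζ
    rw [smul_smul, mul_comm]
  rw [taylorTerm, taylorTerm, this,
    iteratedDeriv_comp_mul_left (fun ζ : ℂ => g (ζ • x)) c n 0, mul_zero, smul_comm]

theorem differentiableOn_line {g : X → Y} (hg : DifferentiableOn ℂ g (Metric.ball 0 1)) {x : X}
    {R : ℝ} (hR : R * ‖x‖ ≤ 1) (hx : ‖x‖ < 1) :
    DifferentiableOn ℂ (fun ζ : ℂ => g (ζ • x)) (Metric.ball 0 R) := by
  refine hg.comp (by fun_prop) ?_
  intro ζ hζ
  rw [mem_ball_zero_iff] at hζ ⊢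
  rw [norm_smul]
  rcases eq_or_ne x 0 with rfl | h0
  · simp
  · exact (mul_lt_mul_of_pos_right hζ (norm_pos_iff.2 h0)).trans_le hR

theorem hasSum_taylorTerm [CompleteSpace Y] {g : X → Y}
    (hg : DifferentiableOn ℂ g (Metric.ball 0 1)) {x : X}
    (hx : ‖x‖ < 1) : HasSum (fun n => taylorTerm g n x) (g x) := by
  have h0 : 0 < 1 + ‖x‖ := by positivity
  -- The slice through `x` is holomorphic on a disc of radius `2 / (1 + ‖x‖) > 1`, so its Taylor
  -- series may be evaluated at `ζ = 1`.
  have hR : 2 / (1 + ‖x‖) * ‖x‖ ≤ 1 := by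
    rw [div_mul_eq_mul_div, div_le_one h0]; linarith
  have := Complex.hasSum_taylorSeries_on_ball (c := 0) (z := 1) (differentiableOn_line hg hR hx)
    (by rw [mem_ball_zero_iff, norm_one, lt_div_iff₀ h0]; linarith)
  simpa [taylorTerm] using this

theorem norm_taylorTerm_le [CompleteSpace Y] {g : X → Y}
    (hg : DifferentiableOn ℂ g (Metric.ball 0 1)) {x : X} {R C : ℝ} (hR : 0 < R)
    (hRx : R * ‖x‖ < 1) (hC : ∀ ζ : ℂ, ‖ζ‖ = R → ‖g (ζ • x)‖ ≤ C) (n : ℕ) :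
    ‖taylorTerm g n x‖ ≤ C / R ^ n := by
  have hd : DifferentiableOn ℂ (fun ζ : ℂ => g (ζ • x)) (closure (Metric.ball 0 R)) := by
    rw [closure_ball _ hR.ne']
    refine hg.comp (by fun_prop) ?_
    intro ζ hζ
    rw [mem_closedBall_zero_iff] at hζ
    rw [mem_ball_zero_iff, norm_smul]
    exact (mul_le_mul_of_nonneg_right hζ (norm_nonneg x)).trans_lt hRx
  have := Complex.norm_iteratedDeriv_le_of_forall_mem_sphere_norm_le n hR hd.diffContOnCl
    (fun ζ hζ => hC ζ (by simpa using hζ))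
  rw [taylorTerm, norm_smul, norm_inv, Complex.norm_natCast, inv_mul_le_iff₀ (by positivity)]
  rwa [mul_div_assoc] at this

/-- A locally uniform limit of holomorphic maps between Banach spaces is holomorphic. -/
theorem differentiableOn_of_tendstoUniformlyOn [CompleteSpace Y] {F : ℕ → X → Y} {f : X → Y}
    {c : X} {r : ℝ} (hF : ∀ j, DifferentiableOn ℂ (F j) (Metric.ball c r))
    (h : TendstoUniformlyOn F f atTop (Metric.ball c r)) :
    DifferentiableOn ℂ f (Metric.ball c r) := by
  intro x hx
  obtain ⟨δ, hδ, hsub⟩ : ∃ δ > 0, ∀ y ∈ Metric.ball x δ, Metric.ball y δ ⊆ Metric.ball c r := by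
    rw [Metric.mem_ball] at hx
    refine ⟨(r - dist x c) / 2, by linarith, fun y hy => Metric.ball_subset_ball' ?_⟩
    rw [Metric.mem_ball] at hy
    linarith [dist_triangle y x c]
  have hxs : Metric.ball x δ ⊆ Metric.ball c r := fun y hy => hsub y hy (Metric.mem_ball_self hδ)
  have hdiff : ∀ j, ∀ y ∈ Metric.ball c r, DifferentiableAt ℂ (F j) y := fun j y hy =>
    (hF j y hy).differentiableAt (Metric.isOpen_ball.mem_nhds hy)
  have hcauchy : UniformCauchySeqOn (fun j => fderiv ℂ (F j)) atTop (Metric.ball x δ) := by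
    rw [Metric.uniformCauchySeqOn_iff]
    intro ε hε
    obtain ⟨N, hN⟩ := Metric.uniformCauchySeqOn_iff.1 h.uniformCauchySeqOn (ε * δ / 4)
      (by positivity)
    refine ⟨N, fun m hm n hn y hy => ?_⟩
    rw [dist_eq_norm, ← fderiv_sub (hdiff m y (hxs hy)) (hdiff n y (hxs hy))]
    refine lt_of_le_of_lt (norm_fderiv_le_of_norm_le (C := ε * δ / 4) hδ
      (((hF m).sub (hF n)).mono (hsub y hy)) fun z hz => ?_) ?_
    · have := hN m hm n hn z (hsub y hy hz)
      rw [dist_eq_norm] at this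
      exact this.le
    · rw [div_lt_iff₀ hδ]
      nlinarith [mul_pos hε hδ]
  have hlim : ∀ y, ∃ A, y ∈ Metric.ball x δ →
      Tendsto (fun j => fderiv ℂ (F j) y) atTop (𝓝 A) := by
    intro y
    by_cases hy : y ∈ Metric.ball x δ
    · obtain ⟨A, hA⟩ := cauchySeq_tendsto_of_complete (hcauchy.cauchySeq hy)
      exact ⟨A, fun _ => hA⟩
    · exact ⟨0, fun h => absurd h hy⟩
  choose A hA using hlim
  have := hasFDerivAt_of_tendstoUniformlyOn Metric.isOpen_ball
    (hcauchy.tendstoUniformlyOn_of_tendsto hA)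
    (fun j y hy => (hdiff j y (hxs hy)).hasFDerivAt)
    (fun y hy => h.tendsto_at (hxs hy)) (Metric.mem_ball_self hδ)
  exact this.differentiableAt.differentiableWithinAt

theorem exists_local_bound {g : X → Y} (hg : DifferentiableOn ℂ g (Metric.ball 0 1)) :
    ∃ r K : ℝ, 0 < r ∧ r < 1 ∧ 0 < K ∧ ∀ y : X, ‖y‖ ≤ r → ‖g y‖ ≤ K := by
  have h0 : ContinuousAt g 0 :=
    ((hg 0 (by simp)).differentiableAt (Metric.ball_mem_nhds 0 one_pos)).continuousAt
  have h1 : ∀ᶠ y in 𝓝 (0 : X), ‖g y‖ < ‖g 0‖ + 1 :=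
    h0.norm.eventually (Iio_mem_nhds (lt_add_one ‖g 0‖))
  obtain ⟨R, hR, h⟩ := Metric.eventually_nhds_iff_ball.1 h1
  refine ⟨min (R / 2) (1 / 2), ‖g 0‖ + 1, by positivity, by
    linarith [min_le_right (R / 2) (1 / 2 : ℝ)], by positivity, fun y hy => (h y ?_).le⟩
  rw [mem_ball_zero_iff]
  linarith [min_le_left (R / 2) (1 / 2 : ℝ)]

/-- The homogeneous Taylor terms of a holomorphic map are holomorphic and bounded on the unit
ball. -/
theorem differentiable_taylorTerm [CompleteSpace Y] {g : X → Y}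
    (hg : DifferentiableOn ℂ g (Metric.ball 0 1)) (n : ℕ) :
    Differentiable ℂ (taylorTerm g n) ∧ ∃ K, ∀ x ∈ Metric.ball (0 : X) 1, ‖taylorTerm g n x‖ ≤ K := by
  obtain ⟨r, K, hr0, hr1, hK0, hK⟩ := exists_local_bound hg
  have hbound : ∀ (x : X) (k : ℕ), ‖x‖ ≤ r / 2 → ‖taylorTerm g k x‖ ≤ K / 2 ^ k := by
    intro x k hx
    refine norm_taylorTerm_le hg two_pos (by linarith) (fun ζ hζ => hK _ ?_) k
    rw [norm_smul, hζ]; linarith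
  have hcr : ((2 / r : ℝ) : ℂ) * ((r / 2 : ℝ) : ℂ) = 1 := by
    rw [← Complex.ofReal_mul]
    have : 2 / r * (r / 2) = 1 := by field_simp
    rw [this, Complex.ofReal_one]
  have hscale : ∀ (m : ℕ) (x : X), taylorTerm g m x =
      ((2 / r : ℝ) : ℂ) ^ m • taylorTerm g m (((r / 2 : ℝ) : ℂ) • x) := by
    intro m x
    rw [← taylorTerm_smul, smul_smul, hcr, one_smul]
  refine ⟨?_, |2 / r| ^ n * (K / 2 ^ n), fun x hx => ?_⟩
  swap
  · rw [hscale, norm_smul, norm_pow, Complex.norm_real, Real.norm_eq_abs]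
    gcongr
    refine hbound _ _ ?_
    rw [mem_ball_zero_iff] at hx
    rw [norm_smul, Complex.norm_real, Real.norm_eq_abs, abs_of_pos (by positivity)]
    nlinarith
  -- Homogeneity carries differentiability from a small ball to the whole space.
  have hglob : ∀ m, DifferentiableOn ℂ (taylorTerm g m) (Metric.ball 0 (r / 2)) →
      Differentiable ℂ (taylorTerm g m) := by
    intro m hm x
    set c : ℂ := ((r / 2 / (‖x‖ + 1) : ℝ) : ℂ) with hc
    have hc0 : c ≠ 0 := by
      rw [hc, Complex.ofReal_ne_zero]; positivity
    have hcx : c • x ∈ Metric.ball (0 : X) (r / 2) := by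
      rw [mem_ball_zero_iff, norm_smul, hc, Complex.norm_real, Real.norm_eq_abs,
        abs_of_pos (by positivity), div_mul_eq_mul_div, div_lt_iff₀ (by positivity)]
      nlinarith
    have he : taylorTerm g m = fun y => (c⁻¹) ^ m • taylorTerm g m (c • y) := by
      funext y
      rw [taylorTerm_smul, smul_smul, ← mul_pow, inv_mul_cancel₀ hc0, one_pow, one_smul]
    rw [he]
    have h1 : DifferentiableAt ℂ (taylorTerm g m) (c • x) :=
      (hm _ hcx).differentiableAt (Metric.isOpen_ball.mem_nhds hcx)
    have h2 : DifferentiableAt ℂ (fun y => taylorTerm g m (c • y)) x :=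
      h1.comp x (by fun_prop)
    exact h2.const_smul _
  induction n using Nat.strong_induction_on with
  | _ n ih =>
  refine hglob n ?_
  set t : ℕ → ℂ := fun j => ((1 / 2 : ℝ) : ℂ) ^ j with ht
  have htn : ∀ j, ‖t j‖ = (1 / 2) ^ j := fun j => by
    rw [ht, norm_pow, Complex.norm_real, Real.norm_eq_abs, abs_of_pos (by norm_num)]
  have ht1 : ∀ j, ‖t j‖ ≤ 1 := fun j => by
    rw [htn]; exact pow_le_one₀ (by norm_num) (by norm_num)
  have ht0 : ∀ j, t j ≠ 0 := fun j => by rw [← norm_pos_iff, htn]; positivity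
  clear_value t
  have hball : ∀ j, MapsTo (fun x : X => t j • x) (Metric.ball 0 (r / 2)) (Metric.ball 0 1) := by
    intro j x hx
    rw [mem_ball_zero_iff] at hx ⊢
    rw [norm_smul]
    nlinarith [ht1 j, norm_nonneg x]
  -- Once the lower terms are known to be holomorphic, the `n`-th is the uniform limit of the
  -- rescaled remainders `t⁻ⁿ (g (t x) - ∑_{k<n} P_k (t x))` as `t → 0`: the tail from degree `n +
  -- 1` on is at most `2 K |t|ⁿ⁺¹`.
  refine differentiableOn_of_tendstoUniformlyOn (F := fun j x => ((t j) ^ n)⁻¹ •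
    (g (t j • x) - ∑ k ∈ Finset.range n, taylorTerm g k (t j • x))) (fun j => ?_) ?_
  · have h1 : DifferentiableOn ℂ (fun x => g (t j • x)) (Metric.ball 0 (r / 2)) :=
      hg.comp (by fun_prop) (hball j)
    have h2 : DifferentiableOn ℂ (fun x => ∑ k ∈ Finset.range n, taylorTerm g k (t j • x))
        (Metric.ball 0 (r / 2)) := by
      refine DifferentiableOn.fun_sum fun k hk => ?_
      have := ih k (Finset.mem_range.1 hk)
      exact (this.comp (by fun_prop : Differentiable ℂ fun x : X => t j • x)).differentiableOn
    exact (h1.sub h2).const_smul _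
  · have hest : ∀ j, ∀ x ∈ Metric.ball (0 : X) (r / 2),
        ‖taylorTerm g n x - ((t j) ^ n)⁻¹ •
          (g (t j • x) - ∑ k ∈ Finset.range n, taylorTerm g k (t j • x))‖ ≤
        (1 / 2) ^ j * (K * 2) := by
      intro j x hx
      have hx' : ‖x‖ ≤ r / 2 := (mem_ball_zero_iff.1 hx).le
      have hs := hasSum_taylorTerm hg (mem_ball_zero_iff.1 (hball j hx))
      have hs1 := (hasSum_nat_add_iff' (n + 1)).2 hs
      have e1 : taylorTerm g n x - ((t j) ^ n)⁻¹ •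
          (g (t j • x) - ∑ k ∈ Finset.range n, taylorTerm g k (t j • x)) =
          -(((t j) ^ n)⁻¹ •
            (g (t j • x) - ∑ k ∈ Finset.range (n + 1), taylorTerm g k (t j • x))) := by
        rw [Finset.sum_range_succ, ← sub_sub, smul_sub _ (_ - _), taylorTerm_smul g n,
          inv_smul_smul₀ (pow_ne_zero _ (ht0 j)), neg_sub]
      have e2 : ‖g (t j • x) - ∑ k ∈ Finset.range (n + 1), taylorTerm g k (t j • x)‖ ≤
          ‖t j‖ ^ (n + 1) * (K * 2) := by
        rw [← hs1.tsum_eq]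
        refine tsum_of_norm_bounded
          ((hasSum_geometric_two.mul_left K).mul_left (‖t j‖ ^ (n + 1))) fun k => ?_
        rw [taylorTerm_smul, norm_smul, norm_pow]
        refine mul_le_mul (pow_le_pow_of_le_one (norm_nonneg _) (ht1 j) (by omega)) ?_
          (norm_nonneg _) (by positivity)
        refine (hbound x _ hx').trans ?_
        rw [one_div, inv_pow, ← div_eq_mul_inv]
        gcongr
        · norm_num
        · omega
      rw [e1, norm_neg, norm_smul, norm_inv, norm_pow, ← htn j]
      rw [inv_mul_le_iff₀ (pow_pos (norm_pos_iff.2 (ht0 j)) n)]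
      refine e2.trans (le_of_eq ?_)
      ring
    rw [Metric.tendstoUniformlyOn_iff]
    intro ε hε
    have hl : Tendsto (fun j : ℕ => (1 / 2 : ℝ) ^ j * (K * 2)) atTop (𝓝 (0 * (K * 2))) :=
      (tendsto_pow_atTop_nhds_zero_of_lt_one (by norm_num) (by norm_num)).mul_const _
    rw [zero_mul] at hl
    filter_upwards [hl.eventually (gt_mem_nhds hε)] with j hj x hx
    rw [dist_eq_norm]
    exact (hest j x hx).trans_lt hj

/-- Lets scalar Cauchy estimates for `φ ∘ g` bound the numerical range of the Taylor terms of `g`.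
-/
theorem taylorTerm_clm_comp {g : X → Y} (hg : DifferentiableOn ℂ g (Metric.ball 0 1))
    [CompleteSpace Y] (φ : StrongDual ℂ Y) (n : ℕ) {x : X} (hx : ‖x‖ ≤ 1) :
    taylorTerm (fun y => φ (g y)) n x = φ (taylorTerm g n x) := by
  have hd : DifferentiableOn ℂ (fun ζ : ℂ => g (ζ • x)) (Metric.ball 0 1) := by
    refine hg.comp (by fun_prop) fun ζ hζ => ?_
    rw [mem_ball_zero_iff] at hζ ⊢
    rw [norm_smul]
    nlinarith [norm_nonneg ζ, norm_nonneg x]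
  have hc : ContDiffAt ℂ n (fun ζ : ℂ => g (ζ • x)) 0 :=
    (hd.analyticAt (Metric.ball_mem_nhds 0 one_pos)).contDiffAt
  rw [taylorTerm, taylorTerm, map_smul, iteratedDeriv_eq_iteratedFDeriv,
    iteratedDeriv_eq_iteratedFDeriv]
  have := φ.iteratedFDeriv_comp_left hc le_rfl
  rw [Function.comp_def] at this
  rw [this]
  rfl

end TaylorTerm

/-- If the numerical range of `g` satisfies a one-sided estimate, then `g` is bounded on each
smaller ball. -/
theorem hasUnitRadiusOfBoundedness_of_re_slice_nonpos [CompleteSpace X] {g : X → X}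
    (hg : DifferentiableOn ℂ g (Metric.ball 0 1))
    (h : ∀ u : X, ‖u‖ = 1 → ∀ φ ∈ dualityMap u, ∀ ζ : ℂ, ‖ζ‖ < 1 →
      (ζ * (starRingEnd ℂ) (φ (g 0)) + dslope (fun z : ℂ => φ (g (z • u))) 0 ζ).re ≤ 0) :
    HasUnitRadiusOfBoundedness g := by
  intro ρ hρ0 hρ1
  obtain ⟨ρ₁, hρρ₁, hρ₁1⟩ := exists_between hρ1
  obtain ⟨ρ₂, hρ₁₂, hρ₂1⟩ := exists_between hρ₁1
  -- Slices are estimated on the circle of radius `r`; the ratio `q = ρ₂ / r < 1` gives geometric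
  -- decay, and the gaps between `ρ`, `ρ₁` and `ρ₂` leave room for `norm_le_of_numericalRange_le`.
  obtain ⟨r, hρ₂r, hr1⟩ := exists_between hρ₂1
  have hr0 : 0 < r := by linarith
  set M := ‖g 0‖ + 1 with hM
  have hM0 : 0 < M := by positivity
  set D := ‖fderiv ℂ g 0‖ with hD
  set Q := 2 * M * r / (1 - r) + D * (1 + r) / (1 - r) with hQ
  have h1r : 0 < 1 - r := by linarith
  have hQ0 : 0 ≤ Q := by positivity
  have hslice : ∀ u : X, ‖u‖ = 1 → ∀ φ ∈ dualityMap u, ∀ ζ : ℂ, ‖ζ‖ = r →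
      ‖φ (g (ζ • u))‖ ≤ M + Q := by
    intro u hu φ hφ ζ hζ
    set ψ : ℂ → ℂ := fun z => φ (g (z • u)) with hψ
    have hφ1 : ‖φ‖ = 1 := by rw [norm_of_mem_dualityMap hφ, hu]
    have hψd : DifferentiableOn ℂ ψ (Metric.ball 0 1) :=
      φ.differentiable.comp_differentiableOn (differentiableOn_slice hg hu.le)
    have hψ0 : ‖ψ 0‖ ≤ ‖g 0‖ := by
      simpa [hψ, hφ1] using φ.le_opNorm (g 0)
    have hq : DifferentiableOn ℂ (dslope ψ 0) (Metric.ball 0 1) :=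
      (Complex.differentiableOn_dslope (Metric.ball_mem_nhds 0 one_pos)).2 hψd
    have hre : MapsTo (dslope ψ 0) (Metric.ball 0 1) {z | z.re ≤ M} := by
      intro z hz
      rw [mem_ball_zero_iff] at hz
      have h1 := h u hu φ hφ z hz
      have h2 : φ (g 0) = ψ 0 := by simp [hψ]
      rw [h2, Complex.add_re] at h1
      have h3 : -‖g 0‖ ≤ (z * (starRingEnd ℂ) (ψ 0)).re := by
        have a1 := Complex.abs_re_le_norm (z * (starRingEnd ℂ) (ψ 0))
        rw [norm_mul, RCLike.norm_conj] at a1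
        have a2 : ‖z‖ * ‖ψ 0‖ ≤ ‖g 0‖ := by nlinarith [norm_nonneg z, norm_nonneg (ψ 0)]
        linarith [neg_abs_le (z * (starRingEnd ℂ) (ψ 0)).re]
      change (dslope ψ 0 z).re ≤ M
      linarith
    have hq0 : ‖dslope ψ 0 0‖ ≤ D := by
      have hg0 : HasFDerivAt g (fderiv ℂ g 0) ((0 : ℂ) • u) := by
        rw [zero_smul]
        exact ((hg 0 (by simp)).differentiableAt (Metric.ball_mem_nhds 0 one_pos)).hasFDerivAt
      have h1 : HasDerivAt (fun z : ℂ => z • u) u 0 := by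
        simpa using (hasDerivAt_id (0 : ℂ)).smul_const u
      have h2 : HasDerivAt ψ (φ (fderiv ℂ g 0 u)) 0 :=
        φ.hasFDerivAt.comp_hasDerivAt 0 (hg0.comp_hasDerivAt 0 h1)
      rw [dslope_same, h2.deriv]
      refine (φ.le_opNorm _).trans ?_
      rw [hφ1, one_mul]
      simpa [hu] using (fderiv ℂ g 0).le_opNorm u
    -- The real part of the slope is bounded above by `M` and its value at `0` by `D`, both
    -- independent of `u` and `φ`, so the resulting bound is uniform over all slices.
    have hbc := Complex.borelCaratheodory hM0 hq hre one_pos (z := ζ)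
      (by rw [mem_ball_zero_iff, hζ]; exact hr1)
    rw [hζ] at hbc
    have hqQ : ‖dslope ψ 0 ζ‖ ≤ Q := hbc.trans (by rw [hQ]; gcongr)
    have e1 : ψ ζ = ψ 0 + ζ * dslope ψ 0 ζ := by
      have := sub_smul_dslope ψ 0 ζ
      simp only [sub_zero, smul_eq_mul] at this
      rw [this]; ring
    change ‖ψ ζ‖ ≤ _
    rw [e1]
    refine (norm_add_le _ _).trans ?_
    rw [norm_mul, hζ]
    nlinarith [norm_nonneg (dslope ψ 0 ζ)]
  set C := M + Q with hC
  have hC0 : 0 < C := by positivity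
  clear_value C
  set q := ρ₂ / r with hq
  have hq0 : 0 < q := div_pos (by linarith) hr0
  have hq1 : q < 1 := (div_lt_one hr0).2 hρ₂r
  have hnum : ∀ n, ∀ z : X, ‖z‖ < ρ₂ → ∀ φ ∈ dualityMap z,
      ‖φ (taylorTerm g n z)‖ ≤ C * q ^ n * ‖z‖ := by
    intro n z hz φ hφ
    rcases eq_or_ne z 0 with rfl | h0
    · have : φ = 0 := by simpa using norm_of_mem_dualityMap hφ
      simp [this]
    · obtain ⟨u, χ, hχ, hu, e1, e2⟩ := exists_unit_of_mem_dualityMap h0 hφ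
      have h1 : ‖χ (taylorTerm g n u)‖ ≤ C / r ^ n := by
        rw [← taylorTerm_clm_comp hg χ n hu.le]
        exact norm_taylorTerm_le (χ.differentiable.comp_differentiableOn hg) hr0
          (by rw [hu, mul_one]; exact hr1) (hslice u hu χ hχ) n
      have h2 : φ (taylorTerm g n z) =
          ((‖z‖ : ℝ) : ℂ) * (((‖z‖ : ℝ) : ℂ) ^ n * χ (taylorTerm g n u)) := by
        conv_lhs => rw [← e1, ← e2]
        rw [taylorTerm_smul, smul_apply, map_smul, smul_eq_mul, smul_eq_mul]
      rw [h2, norm_mul, norm_mul, norm_pow, Complex.norm_real, norm_norm, mul_comm]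
      refine mul_le_mul_of_nonneg_right ?_ (norm_nonneg z)
      have hρ₂0 : 0 ≤ ρ₂ := by linarith
      calc ‖z‖ ^ n * ‖χ (taylorTerm g n u)‖ ≤ ρ₂ ^ n * (C / r ^ n) := by gcongr
        _ = C * q ^ n := by rw [hq, div_pow]; ring
  have hterm : ∀ n, ∀ x : X, ‖x‖ ≤ ρ → ‖taylorTerm g n x‖ ≤ 4 * ρ₁ * C / (ρ₁ - ρ) * q ^ n := by
    intro n x hx
    obtain ⟨hd, K, hK⟩ := differentiable_taylorTerm hg n
    have hV0 : 0 < C * q ^ n := by positivity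
    have hρ₁ρ : 0 < ρ₁ - ρ := by linarith
    -- With `V = C * q ^ n`, the choice of `T` makes `T * V` half the gap `ρ₁ - ρ`, so the norm
    -- bound `2 * ρ₁ / T` is proportional to `q ^ n`.
    have := norm_le_of_numericalRange_le (hd.differentiableOn (s := Metric.ball 0 ρ₂))
      (fun z hz => hK z (Metric.ball_subset_ball hρ₂1.le hz)) (hnum n) hρ₁₂
      (T := (ρ₁ - ρ) / (2 * (C * q ^ n))) (by positivity) hV0.le (x := x) (by
        have : (ρ₁ - ρ) / (2 * (C * q ^ n)) * (C * q ^ n) = (ρ₁ - ρ) / 2 := by field_simp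
        rw [this]; linarith)
    refine this.trans (le_of_eq ?_)
    field_simp
    ring
  refine ⟨4 * ρ₁ * C / (ρ₁ - ρ) * (1 - q)⁻¹, fun x hx => ?_⟩
  rw [mem_closedBall_zero_iff] at hx
  rw [← (hasSum_taylorTerm hg (hx.trans_lt hρ1)).tsum_eq]
  exact tsum_of_norm_bounded ((hasSum_geometric_of_lt_one hq0.le hq1).mul_left _)
    fun n => hterm n x hx

end AbelAverage

/-! ### Dissipativity, numerical radius and Abel averages. -/

namespace AbelAverage

variable {X : Type*} [NormedAddCommGroup X] [NormedSpace ℂ X]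

theorem abelAverage_spec {ω α : ℝ} {D : Set X} {h : X → X} {x : X}
    (hex : ∃ y : X, y ∈ D ∧ y - α • h y = (1 - α * ω) • x) :
    abelAverage ω D h α x ∈ D ∧
      abelAverage ω D h α x - α • h (abelAverage ω D h α x) = (1 - α * ω) • x :=
  ⟨Function.invFunOn_mem hex, Function.invFunOn_eq (f := fun y => y - α • h y) hex⟩

theorem re_apply_sub_smul {h : X → X} {ω : ℝ} {x : X} {φ : StrongDual ℂ X}
    (hφ : φ ∈ dualityMap x) :
    (φ (h x - (ω : ℂ) • x)).re = (φ (h x)).re - ω * ‖x‖ ^ 2 := by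
  rw [map_sub, map_smul, hφ.1, Complex.sub_re, smul_eq_mul, Complex.re_ofReal_mul,
    Complex.ofReal_re]

theorem IsDissipative.numericalRadius_le {h : X → X} {ω : ℝ}
    (hd : IsDissipative ω (Metric.ball (0 : X) 1) h) : numericalRadius h ≤ (ω : EReal) := by
  obtain ⟨ε, hε, ς, hς⟩ := hd
  rw [← EReal.le_of_forall_lt_iff_le]
  intro b hb
  rw [EReal.coe_lt_coe_iff] at hb
  refine limsup_le_of_le (by isBoundedDefault) ?_
  -- Dissipativity at `s • u`, tested with `s • φ` and divided by `s`, gives this bound, whose limit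
  -- is `ω`.
  have hlim : Tendsto (fun s : ℝ => ω * s + ς * (1 - s ^ 2) / s) (𝓝[<] 1)
      (𝓝 (ω * 1 + ς * (1 - 1 ^ 2) / 1)) := by
    refine Tendsto.mono_left (ContinuousAt.tendsto ?_) nhdsWithin_le_nhds
    fun_prop (disch := norm_num)
  filter_upwards [hlim.eventually (gt_mem_nhds (show _ < b by simpa using hb)),
    Ioo_mem_nhdsLT (show max (1 - ε) 0 < 1 from max_lt (by linarith) one_pos)] with s hs hs1
  have hs0 : 0 < s := (le_max_right _ _).trans_lt hs1.1
  refine iSup₂_le ?_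
  rintro _ ⟨u, hu, φ, hφ, rfl⟩
  rw [EReal.coe_le_coe_iff]
  have hn : ‖s • u‖ = s := by rw [norm_smul, hu, mul_one, Real.norm_eq_abs, abs_of_pos hs0]
  have hmem := smul_mem_dualityMap hφ (s : ℂ)
  rw [Complex.coe_smul, Complex.conj_ofReal] at hmem
  have h1 := hς (s • u) (by rw [mem_ball_zero_iff, hn]; exact hs1.2)
    (by rw [hn]; exact (le_max_left _ _).trans_lt hs1.1) (by rw [hn]; exact hs1.2) _ hmem
  rw [hn, smul_apply, smul_eq_mul, Complex.re_ofReal_mul] at h1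
  refine le_trans ?_ hs.le
  refine le_of_mul_le_mul_left (h1.trans (le_of_eq ?_)) hs0
  field_simp

theorem eventually_re_le_of_numericalRadius_le {h : X → X} {ω : ℝ}
    (hr : numericalRadius h ≤ (ω : EReal)) {ε : ℝ} (hε : 0 < ε) :
    ∀ᶠ s : ℝ in 𝓝[<] 1, ∀ u : X, ‖u‖ = 1 → ∀ φ ∈ dualityMap u,
      (φ (h ((s : ℂ) • u) - (ω : ℂ) • (s : ℂ) • u)).re ≤ ε := by
  have h1 : numericalRadius h < ((ω + ε / 2 : ℝ) : EReal) :=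
    hr.trans_lt (EReal.coe_lt_coe_iff.2 (by linarith))
  have h2 := eventually_lt_of_limsup_lt h1
  have h3 : Tendsto (fun s : ℝ => ω + ε / 2 - ω * s) (𝓝[<] 1) (𝓝 (ω + ε / 2 - ω * 1)) :=
    (Continuous.tendsto (by fun_prop) _).mono_left nhdsWithin_le_nhds
  filter_upwards [h2, h3.eventually (gt_mem_nhds (show _ < ε by linarith))] with s hs hs' u hu φ hφ
  have h4 : (((φ (h (s • u))).re : ℝ) : EReal) < ((ω + ε / 2 : ℝ) : EReal) :=
    lt_of_le_of_lt (le_iSup₂_of_le (φ (h (s • u))) ⟨u, hu, φ, hφ, rfl⟩ le_rfl) hs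
  rw [EReal.coe_lt_coe_iff] at h4
  rw [map_sub, map_smul, map_smul, hφ.1, hu, Complex.sub_re, smul_eq_mul, smul_eq_mul,
    Complex.re_ofReal_mul, Complex.re_ofReal_mul, Complex.coe_smul]
  simp only [one_pow, Complex.ofReal_one, Complex.one_re, mul_one]
  linarith

theorem isDissipative_of_re_le {h : X → X} {ω M : ℝ}
    (hd : ∀ z : X, ‖z‖ < 1 → ∀ φ ∈ dualityMap z,
      (φ (h z - (ω : ℂ) • z)).re ≤ M * ‖z‖ * (1 - ‖z‖ ^ 2)) (hM : 0 ≤ M) :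
    IsDissipative ω (Metric.ball (0 : X) 1) h := by
  refine ⟨1, one_pos, M, fun x _ _ hx φ hφ => ?_⟩
  have h1 := hd x hx φ hφ
  rw [re_apply_sub_smul hφ] at h1
  have h2 : M * ‖x‖ * (1 - ‖x‖ ^ 2) ≤ M * (1 - ‖x‖ ^ 2) := by
    have : 0 ≤ 1 - ‖x‖ ^ 2 := by nlinarith [norm_nonneg x]
    gcongr
    nlinarith
  linarith

/-- The equation defining the Abel average in terms of `h - ω I`. -/
theorem sub_smul_eq_iff {ω α μ : ℝ} (hαμ : 1 - α * ω = α * μ) (hα : α ≠ 0) (hμ : μ ≠ 0)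
    {v x y : X} :
    y - α • v = (1 - α * ω) • x ↔ y - ((μ⁻¹ : ℝ) : ℂ) • (v - (ω : ℂ) • y) = x := by
  have h0 : α * μ ≠ 0 := mul_ne_zero hα hμ
  simp only [Complex.coe_smul]
  have : (α * μ) • (y - μ⁻¹ • (v - ω • y)) = y - α • v := by
    have e : α * μ * μ⁻¹ = α := by field_simp
    rw [smul_sub, smul_smul, e, ← hαμ]
    module
  rw [hαμ, ← this, (smul_right_injective X h0).eq_iff]

theorem abelAverageIsHol_zero (ω : ℝ) (h : X → X) :
    AbelAverageIsHol ω (Metric.ball (0 : X) 1) h 0 := by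
  have hex : ∀ x ∈ Metric.ball (0 : X) 1,
      ∃! y : X, y ∈ Metric.ball (0 : X) 1 ∧ y - (0 : ℝ) • h y = (1 - 0 * ω) • x := by
    intro x hx
    refine ⟨x, ⟨hx, by simp⟩, fun z hz => by simpa using hz.2⟩
  refine ⟨hex, differentiableOn_id.congr fun x hx => ?_⟩
  simpa using (abelAverage_spec (hex x hx).exists).2

/-- Here `μ = 1 / α - ω`; its positivity makes the resolvent parameter `μ⁻¹` positive, also for the
negative `α` in `Q_ω` when `ω < 0`. -/
theorem exists_of_mem_paramSet {ω α : ℝ} (hα : α ∈ paramSet ω) (h0 : α ≠ 0) :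
    ∃ μ > 0, 1 - α * ω = α * μ := by
  refine ⟨1 / α - ω, ?_, by field_simp⟩
  rw [gt_iff_lt, sub_pos]
  unfold paramSet at hα
  split_ifs at hα with h1 h2
  · have hα0 : 0 < α := lt_of_le_of_ne hα.1 h0.symm
    have := hα.2
    rw [lt_div_iff₀ h1] at this
    rw [lt_div_iff₀ hα0]; linarith
  · have hα0 : 0 < α := lt_of_le_of_ne hα h0.symm
    rw [h2]; positivity
  · have hω : ω < 0 := lt_of_le_of_ne (not_lt.1 h1) h2
    rcases hα with hα | hα
    · have hα' : α < 1 / ω := hα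
      have hα0 : α < 0 := hα'.trans (one_div_neg.2 hω)
      rw [lt_div_iff_of_neg hω] at hα'
      rw [lt_div_iff_of_neg hα0]; linarith
    · have hα0 : 0 < α := lt_of_le_of_ne hα h0.symm
      exact hω.trans (by positivity)

theorem exists_Ioo_subset_paramSet (ω : ℝ) : ∃ δ > 0, Ioo 0 δ ⊆ paramSet ω := by
  unfold paramSet
  split_ifs with h1 h2
  · exact ⟨1 / ω, by positivity, Ioo_subset_Ico_self⟩
  · exact ⟨1, one_pos, fun x hx => hx.1.le⟩
  · exact ⟨1, one_pos, fun x hx => Or.inr hx.1.le⟩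

/-- The derivative at `α = 0` of a family of holomorphic self-maps of the ball satisfies a
one-sided numerical range estimate. -/
theorem re_le_of_tendsto_selfMaps {Φ : ℝ → X → X} {g : X → X} {δ : ℝ} (hδ : 0 < δ)
    (hΦ : ∀ α ∈ Ioo 0 δ, MapsTo (Φ α) (Metric.ball 0 1) (Metric.ball 0 1) ∧
      DifferentiableOn ℂ (Φ α) (Metric.ball 0 1))
    (hlim : ∀ x ∈ Metric.ball (0 : X) 1,
      Tendsto (fun α : ℝ => α⁻¹ • (Φ α x - x)) (𝓝[>] 0) (𝓝 (g x)))
    {x : X} (hx : ‖x‖ < 1) {φ : StrongDual ℂ X} (hφ : φ ∈ dualityMap x) :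
    (φ (g x)).re ≤ ‖g 0‖ * ‖x‖ * (1 - ‖x‖ ^ 2) := by
  refine re_le_of_slice (fun u hu φ hφ ζ hζ => ?_) hx hφ
  have hφ1 : ‖φ‖ = 1 := by rw [norm_of_mem_dualityMap hφ, hu]
  have hmem : ∀ z : ℂ, ‖z‖ < 1 → z • u ∈ Metric.ball (0 : X) 1 := fun z hz => by
    rw [mem_ball_zero_iff, norm_smul, hu, mul_one]; exact hz
  set k : ℝ → ℂ → ℂ := fun α z => φ (α⁻¹ • (Φ α (z • u) - z • u)) with hk
  have hkval : ∀ α z, k α z = ((α⁻¹ : ℝ) : ℂ) * (φ (Φ α (z • u)) - z) := by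
    intro α z
    have : φ u = 1 := by rw [hφ.1, hu]; simp
    rw [hk]
    simp only
    rw [← Complex.coe_smul, map_smul, map_sub, map_smul, this, smul_eq_mul, smul_eq_mul, mul_one]
  have hklim : ∀ z : ℂ, ‖z‖ < 1 → Tendsto (fun α => k α z) (𝓝[>] 0) (𝓝 (φ (g (z • u)))) :=
    fun z hz => (φ.continuous.tendsto _).comp (hlim _ (hmem z hz))
  -- Since `Φ α` maps into the unit ball and `‖φ‖ = 1`, on `|z| = s` one has Re (z̄ k(z)) ≤ α⁻¹ (s -
  -- s²), which tends to 0 as `s → 1`. The disc lemmas thus apply for each fixed `α`, with a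
  -- constant `‖k α 0‖` that converges as `α → 0⁺`.
  have hest : ∀ α ∈ Ioo 0 δ, (starRingEnd ℂ ζ * k α ζ).re ≤
      (1 - ‖ζ‖ ^ 2) * (‖ζ‖ * ‖k α 0‖) := by
    intro α hα
    obtain ⟨hm, hd⟩ := hΦ α hα
    have hα0 : 0 < α := hα.1
    refine re_conj_mul_le hζ (re_add_dslope_nonpos ?_ ?_ hζ)
    · rw [show k α = fun z => ((α⁻¹ : ℝ) : ℂ) * (φ (Φ α (z • u)) - z) from funext (hkval α)]
      have h1 := φ.differentiable.comp_differentiableOn (differentiableOn_slice hd hu.le)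
      exact (h1.sub differentiableOn_id).const_mul _
    · intro ε hε
      have h1 : Tendsto (fun s : ℝ => α⁻¹ * (s - s ^ 2)) (𝓝[<] 1) (𝓝 (α⁻¹ * (1 - 1 ^ 2))) :=
        (Continuous.tendsto (by fun_prop) _).mono_left nhdsWithin_le_nhds
      filter_upwards [h1.eventually (gt_mem_nhds (show _ < ε by simpa using hε)),
        Ioo_mem_nhdsLT (zero_lt_one' ℝ)] with s hs hs1 z hz
      refine le_trans ?_ hs.le
      have e1 : (starRingEnd ℂ z * k α z).re =
          α⁻¹ * ((starRingEnd ℂ z * φ (Φ α (z • u))).re - s ^ 2) := by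
        have : starRingEnd ℂ z * k α z = ((α⁻¹ : ℝ) : ℂ) *
            (starRingEnd ℂ z * φ (Φ α (z • u)) - ((s ^ 2 : ℝ) : ℂ)) := by
          rw [hkval, ← hz]
          push_cast
          rw [← Complex.conj_mul']
          ring
        rw [this, Complex.re_ofReal_mul, Complex.sub_re, Complex.ofReal_re]
      rw [e1]
      have hin := mem_ball_zero_iff.1 (hm (hmem z (by rw [hz]; exact hs1.2)))
      have e2 : (starRingEnd ℂ z * φ (Φ α (z • u))).re ≤ s := by
        refine (Complex.re_le_norm _).trans ?_
        rw [norm_mul, RCLike.norm_conj, hz]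
        have := φ.le_opNorm (Φ α (z • u))
        rw [hφ1, one_mul] at this
        nlinarith [hs1.1]
      gcongr
  have hL : Tendsto (fun α => (starRingEnd ℂ ζ * k α ζ).re) (𝓝[>] 0)
      (𝓝 (starRingEnd ℂ ζ * φ (g (ζ • u))).re) :=
    (Complex.continuous_re.tendsto _).comp ((hklim ζ hζ).const_mul _)
  have hR : Tendsto (fun α => (1 - ‖ζ‖ ^ 2) * (‖ζ‖ * ‖k α 0‖)) (𝓝[>] 0)
      (𝓝 ((1 - ‖ζ‖ ^ 2) * (‖ζ‖ * ‖φ (g ((0 : ℂ) • u))‖))) :=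
    (((hklim 0 (by simp)).norm).const_mul _).const_mul _
  refine (le_of_tendsto_of_tendsto hL hR ?_).trans ?_
  · filter_upwards [Ioo_mem_nhdsGT hδ] with α hα using hest α hα
  · have h1 := φ.le_opNorm (g 0)
    rw [hφ1, one_mul] at h1
    rw [zero_smul]
    have : 0 ≤ 1 - ‖ζ‖ ^ 2 := by nlinarith [norm_nonneg ζ]
    gcongr

variable [CompleteSpace X]

/-- Dividing the equation by `α * μ` reduces it to the resolvent of `G = μ⁻¹ (h - ωI)`; as `μ > 0`,
`G` inherits (E) with constant `μ⁻¹ * M`. -/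
theorem abelAverageIsHol_of_re_le {h : X → X} (hh : DifferentiableOn ℂ h (Metric.ball 0 1))
    {ω M : ℝ} (hM : 0 ≤ M) (hb : HasUnitRadiusOfBoundedness fun z => h z - (ω : ℂ) • z)
    (hd : ∀ z : X, ‖z‖ < 1 → ∀ φ ∈ dualityMap z,
      (φ (h z - (ω : ℂ) • z)).re ≤ M * ‖z‖ * (1 - ‖z‖ ^ 2))
    {α μ : ℝ} (hαμ : 1 - α * ω = α * μ) (hα : α ≠ 0) (hμ : 0 < μ) :
    AbelAverageIsHol ω (Metric.ball (0 : X) 1) h α := by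
  set G : X → X := fun z => ((μ⁻¹ : ℝ) : ℂ) • (h z - (ω : ℂ) • z) with hG
  have hGd : DifferentiableOn ℂ G (Metric.ball 0 1) := by fun_prop
  have hGb : HasUnitRadiusOfBoundedness G := by
    intro r hr0 hr1
    obtain ⟨C, hC⟩ := hb r hr0 hr1
    refine ⟨|μ⁻¹| * C, fun x hx => ?_⟩
    rw [hG, norm_smul, Complex.norm_real, Real.norm_eq_abs]
    exact mul_le_mul_of_nonneg_left (hC x hx) (abs_nonneg _)
  have hGK : ∀ z : X, ‖z‖ < 1 → ∀ φ ∈ dualityMap z,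
      (φ (G z)).re ≤ μ⁻¹ * M * ‖z‖ * (1 - ‖z‖ ^ 2) := by
    intro z hz φ hφ
    rw [hG, map_smul, smul_eq_mul, Complex.re_ofReal_mul]
    have := mul_le_mul_of_nonneg_left (hd z hz φ hφ) (inv_pos.2 hμ).le
    linarith
  have hsol := fun x hx => existsUnique_sub_eq hGd hGb (M := μ⁻¹ * M) (by positivity) hGK (x := x) hx
  have hiff : ∀ x y : X, y - α • h y = (1 - α * ω) • x ↔ y - G y = x := fun x y =>
    sub_smul_eq_iff hαμ hα hμ.ne'
  have hex : ∀ x ∈ Metric.ball (0 : X) 1,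
      ∃! y : X, y ∈ Metric.ball (0 : X) 1 ∧ y - α • h y = (1 - α * ω) • x := by
    intro x hx
    obtain ⟨y, h1, h2, h3, -⟩ := hsol x (by simpa using hx)
    refine ⟨y, ⟨by simpa using h1, (hiff x y).2 h2⟩, fun z hz => ?_⟩
    exact h3 z (by simpa using hz.1) ((hiff x z).1 hz.2)
  refine ⟨hex, differentiableOn_of_sub_eq hGd fun x hx => ?_⟩
  obtain ⟨h1, h2⟩ := abelAverage_spec (hex x hx).exists
  rw [hiff] at h2
  obtain ⟨y, -, -, h3, h4⟩ := hsol x (by simpa using hx)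
  have hy := h3 _ (by simpa using h1) h2
  refine ⟨h1, h2, fun z hz hzx => ?_, by rw [hy]; exact h4⟩
  rw [hy]
  exact h3 z (by simpa using hz) hzx

/-- For small `α > 0` the Abel average at `x` is `O(α)`-close to `x`. -/
theorem eventually_norm_abelAverage_sub_le {h : X → X}
    (hh : DifferentiableOn ℂ h (Metric.ball 0 1)) {ω : ℝ}
    (hp : IsPseudoContractive ω (Metric.ball (0 : X) 1) h) {x : X}
    (hx : x ∈ Metric.ball (0 : X) 1) :
    ∃ C : ℝ, ∀ᶠ α : ℝ in 𝓝[>] 0, 0 < α ∧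
      abelAverage ω (Metric.ball (0 : X) 1) h α x -
        α • h (abelAverage ω (Metric.ball (0 : X) 1) h α x) = (1 - α * ω) • x ∧
      ‖abelAverage ω (Metric.ball (0 : X) 1) h α x - x‖ ≤ α * C := by
  obtain ⟨δ, hδ, hhol⟩ := hp
  obtain ⟨K, s, hs, hK⟩ := (hasStrictFDerivAt Metric.isOpen_ball hh hx).exists_lipschitzOnWith
  obtain ⟨ρ, hρ, hsub⟩ := Metric.nhds_basis_closedBall.mem_iff.1
    (inter_mem hs (Metric.isOpen_ball.mem_nhds hx))
  set C := |ω| * ‖x‖ + (‖h x‖ + K * ρ) with hC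
  have hhC : ∀ y ∈ Metric.closedBall x ρ, ‖h y‖ ≤ ‖h x‖ + K * ρ := by
    intro y hy
    have h1 := hK.dist_le_mul y (hsub hy).1 x (mem_of_mem_nhds hs)
    rw [dist_eq_norm] at h1
    have h2 : (K : ℝ) * dist y x ≤ K * ρ := by
      gcongr; exact hy
    have h3 := norm_add_le (h y - h x) (h x)
    rw [sub_add_cancel] at h3
    linarith
  have hsmall : ∀ A a : ℝ, 0 < a → ∀ᶠ α : ℝ in 𝓝[>] 0, α * A < a := by
    intro A a ha
    have : Tendsto (fun α : ℝ => α * A) (𝓝[>] 0) (𝓝 (0 * A)) :=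
      (Continuous.tendsto (by fun_prop) _).mono_left nhdsWithin_le_nhds
    rw [zero_mul] at this
    exact this.eventually (gt_mem_nhds ha)
  refine ⟨C, ?_⟩
  filter_upwards [hsmall C ρ hρ, hsmall K (1 / 2) (by norm_num), Ioo_mem_nhdsGT hδ]
    with α hαC hαK hα
  have hα0 : 0 < α := hα.1
  -- For small `α` this is a contraction of a fixed small ball about `x`, displacing points by at
  -- most `α * C` from `x`. Uniqueness in the whole unit ball identifies its fixed point with the
  -- Abel average.
  set T : X → X := fun y => (1 - α * ω) • x + α • h y with hT
  have hTx : ∀ y ∈ Metric.closedBall x ρ, ‖T y - x‖ ≤ α * C := by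
    intro y hy
    have e : T y - x = α • (h y - ω • x) := by rw [hT]; module
    rw [e, norm_smul, Real.norm_eq_abs, abs_of_pos hα0]
    gcongr
    refine (norm_sub_le _ _).trans ?_
    rw [norm_smul, Real.norm_eq_abs]
    linarith [hhC y hy]
  have hmaps : MapsTo T (Metric.closedBall x ρ) (Metric.closedBall x ρ) := by
    intro y hy
    rw [mem_closedBall_iff_norm]
    exact (hTx y hy).trans hαC.le
  have hlip : LipschitzOnWith (1 / 2) T (Metric.closedBall x ρ) := by
    refine LipschitzOnWith.of_dist_le_mul fun y hy z hz => ?_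
    have h1 := hK.dist_le_mul y (hsub hy).1 z (hsub hz).1
    rw [hT, dist_add_left, dist_smul₀, Real.norm_eq_abs, abs_of_pos hα0]
    calc α * dist (h y) (h z) ≤ α * (K * dist y z) := by gcongr
      _ = (α * K) * dist y z := by ring
      _ ≤ _ := by
        gcongr
        have h2 : ((1 / 2 : NNReal) : ℝ) = 1 / 2 := by norm_num
        rw [h2]; exact hαK.le
  have hcontr : ContractingWith (1 / 2) (hmaps.restrict T _ _) :=
    ⟨by rw [← NNReal.coe_lt_coe]; norm_num, hlip.mapsToRestrict hmaps⟩
  obtain ⟨y, hy, hyT, -, -⟩ := hcontr.exists_fixedPoint' Metric.isClosed_closedBall.isComplete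
    hmaps (Metric.mem_closedBall_self hρ.le) (edist_ne_top _ _)
  have hyT' : (1 - α * ω) • x + α • h y = y := hyT
  have huniq := (hhol α hα).1 x hx
  have hspec := abelAverage_spec huniq.exists
  have hey : abelAverage ω (Metric.ball (0 : X) 1) h α x = y :=
    huniq.unique hspec ⟨(hsub hy).2, sub_eq_iff_eq_add.2 hyT'.symm⟩
  refine ⟨hα0, hspec.2, ?_⟩
  rw [hey]
  have := hTx y hy
  rwa [hyT.eq] at this

theorem tendsto_abelAverage {h : X → X}
    (hh : DifferentiableOn ℂ h (Metric.ball 0 1)) {ω : ℝ}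
    (hp : IsPseudoContractive ω (Metric.ball (0 : X) 1) h) {x : X}
    (hx : x ∈ Metric.ball (0 : X) 1) :
    Tendsto (fun α : ℝ => abelAverage ω (Metric.ball (0 : X) 1) h α x) (𝓝[>] 0) (𝓝 x) ∧
      Tendsto (fun α : ℝ => α⁻¹ • (abelAverage ω (Metric.ball (0 : X) 1) h α x - x))
        (𝓝[>] 0) (𝓝 (h x - ω • x)) := by
  obtain ⟨C, hC⟩ := eventually_norm_abelAverage_sub_le hh hp hx
  have h1 : Tendsto (fun α : ℝ => abelAverage ω (Metric.ball (0 : X) 1) h α x) (𝓝[>] 0)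
      (𝓝 x) := by
    rw [tendsto_iff_norm_sub_tendsto_zero]
    have h0 : Tendsto (fun α : ℝ => α * C) (𝓝[>] 0) (𝓝 (0 * C)) :=
      (Continuous.tendsto (by fun_prop) _).mono_left nhdsWithin_le_nhds
    rw [zero_mul] at h0
    exact squeeze_zero' (Eventually.of_forall fun _ => norm_nonneg _)
      (hC.mono fun α hα => hα.2.2) h0
  refine ⟨h1, ?_⟩
  have hcont : ContinuousAt h x :=
    ((hh x hx).differentiableAt (Metric.isOpen_ball.mem_nhds hx)).continuousAt
  refine ((hcont.tendsto.comp h1).sub_const (ω • x)).congr' ?_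
  filter_upwards [hC] with α hαC
  obtain ⟨hα, he, -⟩ := hαC
  set y := abelAverage ω (Metric.ball (0 : X) 1) h α x
  -- The difference quotient is exactly `h (Φ_α x) - ω x`, so the second limit follows from the
  -- first by continuity of `h`.
  have : y - x = α • (h y - ω • x) := by
    rw [sub_eq_iff_eq_add] at he ⊢
    nth_rewrite 1 [he]
    module
  rw [this, inv_smul_smul₀ hα.ne']
  rfl

end AbelAverage

/-! ### The equivalence, along the cycle (i) → (ii) → (iv) → (iii) → (i). -/

theorem theorem2 {X : Type*} [NormedAddCommGroup X] [NormedSpace ℂ X] [CompleteSpace X]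
    (h : X → X) (hh : DifferentiableOn ℂ h (Metric.ball (0 : X) 1)) (ω : ℝ) :
    List.TFAE
      [ AbelAverage.IsDissipative ω (Metric.ball (0 : X) 1) h,
        AbelAverage.numericalRadius h ≤ (ω : EReal),
        AbelAverage.HasUnitRadiusOfBoundedness h ∧
          AbelAverage.IsPseudoContractive ω (Metric.ball (0 : X) 1) h ∧
          ∀ x ∈ Metric.ball (0 : X) 1,
            Tendsto (fun α : ℝ => AbelAverage.abelAverage ω (Metric.ball (0 : X) 1) h α x)
              (𝓝[>] 0) (𝓝 x) ∧
            Tendsto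
              (fun α : ℝ =>
                α⁻¹ • (AbelAverage.abelAverage ω (Metric.ball (0 : X) 1) h α x - x))
              (𝓝[>] 0) (𝓝 (h x - ω • x)),
        AbelAverage.HasUnitRadiusOfBoundedness h ∧
          ∀ α ∈ AbelAverage.paramSet ω,
            AbelAverage.AbelAverageIsHol ω (Metric.ball (0 : X) 1) h α ] := by
  tfae_have 1 → 2 := fun h1 => h1.numericalRadius_le
  tfae_have 2 → 4 := by
    intro h2
    have hg : DifferentiableOn ℂ (fun z => h z - (ω : ℂ) • z) (Metric.ball 0 1) := by fun_prop
    have hB := fun (u : X) (hu : ‖u‖ = 1) φ (hφ : φ ∈ AbelAverage.dualityMap u) (ζ : ℂ)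
      (hζ : ‖ζ‖ < 1) => AbelAverage.re_slice_nonpos hg
        (fun ε hε => AbelAverage.eventually_re_le_of_numericalRadius_le h2 hε) hu hφ hζ
    -- The slice inequality `hB` is used twice: here for boundedness of `h - ωI`, and below for (E).
    have hb := AbelAverage.hasUnitRadiusOfBoundedness_of_re_slice_nonpos hg hB
    refine ⟨fun r hr0 hr1 => ?_, fun α hα => ?_⟩
    · obtain ⟨C, hC⟩ := hb r hr0 hr1
      refine ⟨C + |ω| * r, fun x hx => ?_⟩
      have h3 := hC x hx
      have h4 := norm_add_le (h x - (ω : ℂ) • x) ((ω : ℂ) • x)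
      rw [sub_add_cancel, norm_smul, Complex.norm_real, Real.norm_eq_abs] at h4
      have h5 : |ω| * ‖x‖ ≤ |ω| * r := by
        gcongr; simpa using hx
      linarith
    · rcases eq_or_ne α 0 with rfl | h0
      · exact AbelAverage.abelAverageIsHol_zero ω h
      · obtain ⟨μ, hμ, hαμ⟩ := AbelAverage.exists_of_mem_paramSet hα h0
        refine AbelAverage.abelAverageIsHol_of_re_le hh (norm_nonneg (h 0 - (ω : ℂ) • 0)) hb
          (fun z hz φ hφ => AbelAverage.re_le_of_slice (g := fun z => h z - (ω : ℂ) • z)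
            (fun u hu φ hφ ζ hζ => ?_) hz hφ) hαμ h0 hμ
        have h3 := AbelAverage.re_conj_mul_le (ψ := fun z : ℂ => φ (h (z • u) - (ω : ℂ) • z • u))
          hζ (by simpa using hB u hu φ hφ ζ hζ)
        refine h3.trans ?_
        have h4 := φ.le_opNorm (h 0 - (ω : ℂ) • 0)
        rw [AbelAverage.norm_of_mem_dualityMap hφ, hu, one_mul] at h4
        have : 0 ≤ 1 - ‖ζ‖ ^ 2 := by nlinarith [norm_nonneg ζ]
        simp only [zero_smul]
        gcongr
  tfae_have 4 → 3 := by
    rintro ⟨h1, h2⟩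
    obtain ⟨δ, hδ, hsub⟩ := AbelAverage.exists_Ioo_subset_paramSet ω
    have hp : AbelAverage.IsPseudoContractive ω (Metric.ball (0 : X) 1) h :=
      ⟨δ, hδ, fun α hα => h2 α (hsub hα)⟩
    exact ⟨h1, hp, fun x hx => AbelAverage.tendsto_abelAverage hh hp hx⟩
  tfae_have 3 → 1 := by
    rintro ⟨-, ⟨δ, hδ, hhol⟩, hlim⟩
    refine AbelAverage.isDissipative_of_re_le (M := ‖h 0 - (ω : ℂ) • (0 : X)‖)
      (fun z hz φ hφ => ?_) (norm_nonneg _)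
    refine AbelAverage.re_le_of_tendsto_selfMaps (g := fun z => h z - (ω : ℂ) • z)
      (Φ := AbelAverage.abelAverage ω (Metric.ball (0 : X) 1) h) hδ
      (fun α hα => ⟨fun x hx => ?_, (hhol α hα).2⟩) (fun x hx => ?_) hz hφ
    · exact (AbelAverage.abelAverage_spec ((hhol α hα).1 x hx).exists).1
    · simpa only [Complex.coe_smul] using (hlim x hx).2
  tfae_finish
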